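/- A permutation $\pi$ of length $n$ contains a permutation $\beta$ of length $k$ if some subsequence $\pi(i_1)\pi(i_2)\cdots\pi(i_k)$, $i_1<\cdots<i_k$, is in the same relative order as $\beta(1)\beta(2)\cdots\beta(k)$; for a set $B$ of permutations, $\operatorname{Av}(B)$ is the class of all permutations that contain no element of $B$. An interval of $\pi$ is a set of contiguous indices whose set of values under $\pi$ is also contiguous, and $\pi$ is simple if its only intervals are those of lengths $0$, $1$ and $n$. Theorem (Brignall, Ruškuc and Vatter). It is decidable whether a permutation class given by a finite basis contains infinitely many simple permutations. That is, there is an algorithm that, given any finite list $B$ of permutations written in one-line notation, always halts and answers whether $\operatorname{Av}(B)$ contains infinitely many simple permutations. (Precisely: the set of finite lists of finite words over $\mathbb{N}$ that are the list of one-line notations of some finite list $B$ of permutations for which $\operatorname{Av}(B)$ contains infinitely many simple permutations is a recursive set.) -/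

import Mathlib

/-- A finite permutation: its length `n` together with a permutation of `n` ordered points. -/
abbrev Permutation : Type := Σ n : ℕ, Equiv.Perm (Fin n)

namespace Permutation

/-- The one-line notation `π(1) π(2) ⋯ π(n)`, with values in `{1, …, n}`. -/
def oneLine (π : Permutation) : List ℕ :=
  List.ofFn fun i : Fin π.1 => ((π.2 i : Fin π.1) : ℕ) + 1

/-- `π.Contains σ`: some subsequence of `π` is order isomorphic to `σ`. -/
def Contains (π σ : Permutation) : Prop :=
  ∃ f : Fin σ.1 ↪o Fin π.1, ∀ i j : Fin σ.1, σ.2 i < σ.2 j ↔ π.2 (f i) < π.2 (f j)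

/-- A set of contiguous indices whose set of values is also contiguous. -/
def IsInterval (π : Permutation) (I : Set (Fin π.1)) : Prop :=
  I.OrdConnected ∧ (π.2 '' I).OrdConnected

/-- The only intervals of `π` are those of lengths `0`, `1` and the length of `π`. -/
def IsSimple (π : Permutation) : Prop :=
  ∀ I : Set (Fin π.1), π.IsInterval I → I.ncard = 0 ∨ I.ncard = 1 ∨ I.ncard = π.1

/-- The class of all permutations that contain no member of `B`. -/
def Av (B : Set Permutation) : Set Permutation :=
  {π | ∀ β ∈ B, ¬ π.Contains β}

end Permutation

/-! Long simple permutations are unavoidably built from four families: pin sequences, parallel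
alternations, wedges with a point in the mouth, and wedges with two extra points at the tip. All
four are encoded by words over one finite alphabet of 64 letters. Validity of a word is a condition
on its first letter and on consecutive letters, and the relative position of two of its points
depends only on their letters and on whether they are adjacent. The central equivalence,
`infinite_simple_iff`, says that a class has infinitely many simple members exactly when arbitrarily
long valid words avoid its basis.

From simple permutations to words: start from two points and take vertical and horizontal hulls in
turn. A point that first appears late ends a long pin sequence (`exists_pinSeq`). Without long pin
sequences the hulls of every pair therefore exhaust the permutation in boundedly many steps. Tracing
this growth backwards, if every line separated few pairs of neighbours, only few pairs could reach a
given line, although all of them do (`exists_many_straddles`). So some line separates many pairs of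
neighbours, and the Erdős–Szekeres argument extracts a long parallel alternation or a long wedge.
For a wedge, the hulls of its first two points must leave the mouth in few steps, so one step
crosses many wedge points; the escaping point completes one of the two wedge families
(`Wedge.hasAlternation_of_jump`).

From words to simple permutations: the alternations are simple at suitable lengths, and a pin
sequence is simple after trimming its end and perhaps deleting one of its first two points
(`Valid.exists_hasSimple`).

Decidability: whether a pattern occurs in a word is tracked letter by letter by a finite set of
partial occurrences (`profiles_succ`). An avoiding valid word longer than the number of states
repeats a state and can be pumped. Hence it suffices to search the words of one length, which is
primitive recursive in the basis. -/

namespace PinWords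

/-! ### Words encoding pin sequences and alternations -/

/-- `Cmp b x y` says `x < y` if `b` is true and `y < x` otherwise. -/
def Cmp : Bool → ℤ → ℤ → Prop
  | true, x, y => x < y
  | false, x, y => y < x

@[simp] theorem cmp_true (x y : ℤ) : Cmp true x y ↔ x < y := Iff.rfl
@[simp] theorem cmp_false (x y : ℤ) : Cmp false x y ↔ y < x := Iff.rfl

theorem Cmp.lt_iff {b : Bool} {x y : ℤ} (h : Cmp b x y) : x < y ↔ b = true := by
  cases b <;> simp at h ⊢ <;> omega

theorem Cmp.gt_iff {b : Bool} {x y : ℤ} (h : Cmp b x y) : y < x ↔ b = false := by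
  cases b <;> simp at h ⊢ <;> omega

/-- A letter consists of three bits and a kind. The kind `7` is that of the letters of pin
sequences, whose bits are the orientation of the pin, the side of the previous pin and its own side.
The other kinds are those of the points of alternations: upper and lower points of a parallel
alternation (`0`, `1`) and of a wedge (`2`, `3`), a point in the mouth of a wedge (`4`), a point at
the tip of a wedge (`5`) and a point above a wedge (`6`). Their bits are a symmetry of the plane. -/
abbrev Letter : Type := (Bool × Bool × Bool) × Fin 8

/-- Whether a point of kind `s` is to the left of a later point. -/
def baseX (s : Fin 8) : Bool := decide (s ≠ 4)

/-- Whether a point of kind `s` is below a later point of kind `t`. -/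
def baseY (s t : Fin 8) : Bool :=
  if t = 1 then decide (s = 1) else if t = 3 then false else decide (s ≠ 6)

/-- Whether a point with letter `a` is to the left of a later point with letter `b`. -/
def letterX (a b : Letter) (adj : Bool) : Bool :=
  if b.2 = 7 then (if b.1.1 then b.1.2.2 else adj ^^ b.1.2.1)
  else if b.1.1 then baseY a.2 b.2 ^^ b.1.2.2 else baseX a.2 ^^ b.1.2.1

/-- Whether a point with letter `a` is below a later point with letter `b`. -/
def letterY (a b : Letter) (adj : Bool) : Bool :=
  if b.2 = 7 then (if b.1.1 then adj ^^ b.1.2.1 else b.1.2.2)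
  else if b.1.1 then baseX a.2 ^^ b.1.2.1 else baseY a.2 b.2 ^^ b.1.2.2

/-- The kinds that may follow each other in alternations. -/
def baseNext (s t : Fin 8) : Prop :=
  (s, t) ∈ ([(0, 1), (1, 0), (4, 2), (2, 3), (3, 2), (5, 6), (6, 2)] : List (Fin 8 × Fin 8))

instance : DecidableRel baseNext := fun _ _ => inferInstanceAs (Decidable (_ ∈ _))

/-- The letters that may follow each other. -/
def letterNext (a b : Letter) : Prop :=
  if b.2 = 7 then a.2 = 7 ∧ b.1.1 = !a.1.1 ∧ b.1.2.1 = a.1.2.2 else a.1 = b.1 ∧ baseNext a.2 b.2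

/-- The kinds of the initial letters of words. -/
def baseStart (s : Fin 8) : Prop := s = 0 ∨ s = 4 ∨ s = 5 ∨ s = 7

/-- The first `N` letters of `u` form a valid word. -/
def Valid (u : ℕ → Letter) (N : ℕ) : Prop :=
  baseStart (u 0).2 ∧ ∀ i, i + 1 < N → letterNext (u i) (u (i + 1))

variable {α : Type*}

/-- The points `f 0, …, f (N - 1)` are placed as the word `u` says. -/
def Realizes (X Y : α → ℤ) (u : ℕ → Letter) (f : ℕ → α) (N : ℕ) : Prop :=
  ∀ i j, i < j → j < N →
    Cmp (letterX (u i) (u j) (decide (j = i + 1))) (X (f i)) (X (f j)) ∧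
    Cmp (letterY (u i) (u j) (decide (j = i + 1))) (Y (f i)) (Y (f j))

/-- Realization of a sequence of kinds of points of alternations. -/
def BaseReal (X Y : α → ℤ) (t : ℕ → Fin 8) (f : ℕ → α) (N : ℕ) : Prop :=
  ∀ i j, i < j → j < N →
    Cmp (baseX (t i)) (X (f i)) (X (f j)) ∧ Cmp (baseY (t i) (t j)) (Y (f i)) (Y (f j))

/-- Change the sign if `b` is true. -/
def sgn (b : Bool) (z : ℤ) : ℤ := if b then -z else z

/-- The first coordinate after applying the symmetry `g`. -/
def symX (g : Bool × Bool × Bool) (X Y : α → ℤ) (a : α) : ℤ := sgn g.2.1 (if g.1 then Y a else X a)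

/-- The second coordinate after applying the symmetry `g`. -/
def symY (g : Bool × Bool × Bool) (X Y : α → ℤ) (a : α) : ℤ := sgn g.2.2 (if g.1 then X a else Y a)

theorem cmp_sgn (b c : Bool) (x y : ℤ) : Cmp b (sgn c x) (sgn c y) ↔ Cmp (b ^^ c) x y := by
  cases b <;> cases c <;> simp [sgn]

/-- All letters of an alternation carry the same symmetry, so the symmetry can be moved from the
word to the coordinates; only the eight kinds then need attention. -/
theorem realizes_sym (g : Bool × Bool × Bool) (X Y : α → ℤ) (t : ℕ → Fin 8) (ht : ∀ n, t n ≠ 7)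
    (f : ℕ → α) (N : ℕ) :
    Realizes X Y (fun n => (g, t n)) f N ↔ BaseReal (symX g X Y) (symY g X Y) t f N := by
  unfold Realizes BaseReal
  refine forall₄_congr fun i j _ _ => ?_
  obtain ⟨s, a, b⟩ := g
  cases s <;> simp [letterX, letterY, ht, symX, symY, cmp_sgn, and_comm]

/-- The sequences of kinds of points that occur in simple alternations. -/
def BaseValid (t : ℕ → Fin 8) (N : ℕ) : Prop :=
  (∀ n, t n ≠ 7) ∧ baseStart (t 0) ∧ ∀ i, i + 1 < N → baseNext (t i) (t (i + 1))

/-- Some symmetric image contains an alternation of length `N` of one of the simple types. -/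
def HasAlternation (X Y : α → ℤ) (N : ℕ) : Prop :=
  ∃ g t f, BaseValid t N ∧ BaseReal (symX g X Y) (symY g X Y) t f N

theorem HasAlternation.exists_word {X Y : α → ℤ} {N : ℕ} (h : HasAlternation X Y N) :
    ∃ u f, Valid u N ∧ Realizes X Y u f N := by
  obtain ⟨g, t, f, ⟨h7, hs, hn⟩, hr⟩ := h
  refine ⟨fun n => (g, t n), f, ⟨hs, fun i hi => ?_⟩, (realizes_sym g X Y t h7 f N).2 hr⟩
  simpa [letterNext, h7] using hn i hi

/-- The symmetries of the square are closed under composition. Alternations found after several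
reflections can thus be carried back to the original coordinates. -/
theorem exists_sym_sym (g g' : Bool × Bool × Bool) : ∃ g'' : Bool × Bool × Bool,
    ∀ X Y : α → ℤ, symX g'' X Y = symX g' (symX g X Y) (symY g X Y) ∧
      symY g'' X Y = symY g' (symX g X Y) (symY g X Y) := by
  obtain ⟨s, a, b⟩ := g
  obtain ⟨s', a', b'⟩ := g'
  refine ⟨(s ^^ s', (if s' then b else a) ^^ a', (if s' then a else b) ^^ b'), fun X Y => ?_⟩
  constructor <;> funext p <;> cases s <;> cases a <;> cases b <;> cases s' <;> cases a' <;>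
    cases b' <;> simp [symX, symY, sgn]

theorem HasAlternation.of_sym {X Y : α → ℤ} {N : ℕ} (g : Bool × Bool × Bool)
    (h : HasAlternation (symX g X Y) (symY g X Y) N) : HasAlternation X Y N := by
  obtain ⟨g', t, f, hv, hr⟩ := h
  obtain ⟨g'', hg⟩ := exists_sym_sym (α := α) g g'
  exact ⟨g'', t, f, hv, by rwa [(hg X Y).1, (hg X Y).2]⟩

theorem HasAlternation.of_base {X Y : α → ℤ} {N : ℕ} {t : ℕ → Fin 8} {f : ℕ → α}
    (hv : BaseValid t N) (hr : BaseReal X Y t f N) : HasAlternation X Y N :=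
  ⟨(false, false, false), t, f, hv, hr⟩

/-- The kinds along a parallel alternation. -/
def parKind (n : ℕ) : Fin 8 := if n % 2 = 0 then 0 else 1

/-- The kinds along a wedge preceded by a point in its mouth. -/
def mouthKind (n : ℕ) : Fin 8 := if n = 0 then 4 else if n % 2 = 1 then 2 else 3

/-- The kinds along a wedge preceded by a point at its tip and a point above it. -/
def tipKind (n : ℕ) : Fin 8 :=
  if n = 0 then 5 else if n = 1 then 6 else if n % 2 = 0 then 2 else 3

theorem baseValid_parKind (N : ℕ) : BaseValid parKind N := by
  refine ⟨fun n => ?_, by simp [baseStart, parKind], fun i _ => ?_⟩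
  · unfold parKind; split_ifs <;> decide
  · rcases Nat.mod_two_eq_zero_or_one i with h | h
    · have : (i + 1) % 2 = 1 := by omega
      simp [parKind, h, this, baseNext]
    · have : (i + 1) % 2 = 0 := by omega
      simp [parKind, h, this, baseNext]

theorem baseValid_mouthKind (N : ℕ) : BaseValid mouthKind N := by
  refine ⟨fun n => ?_, by simp [baseStart, mouthKind], fun i _ => ?_⟩
  · unfold mouthKind; split_ifs <;> decide
  · rcases Nat.eq_zero_or_pos i with rfl | hi
    · simp [mouthKind, baseNext]
    rcases Nat.mod_two_eq_zero_or_one i with h | h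
    · have : (i + 1) % 2 = 1 := by omega
      simp [mouthKind, h, this, baseNext, hi.ne']
    · have : (i + 1) % 2 = 0 := by omega
      simp [mouthKind, h, this, baseNext, hi.ne']

theorem baseValid_tipKind (N : ℕ) : BaseValid tipKind N := by
  refine ⟨fun n => ?_, by simp [baseStart, tipKind], fun i _ => ?_⟩
  · unfold tipKind; split_ifs <;> decide
  · rcases Nat.eq_zero_or_pos i with rfl | hi
    · simp [tipKind, baseNext]
    rcases Nat.eq_or_lt_of_le (Nat.succ_le_of_lt hi) with rfl | hi'
    · simp [tipKind, baseNext]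
    have h1 : i ≠ 1 := by omega
    rcases Nat.mod_two_eq_zero_or_one i with h | h
    · have : (i + 1) % 2 = 1 := by omega
      simp [tipKind, h, this, baseNext, hi.ne', h1]
    · have : (i + 1) % 2 = 0 := by omega
      simp [tipKind, h, this, baseNext, hi.ne', h1]

/-! ### Monotone subsequences -/

/-- The Erdős–Szekeres theorem with a Ramsey-type bound: the least index is split off, and the
remaining ones are divided according to whether their value exceeds its value. It extends an
increasing set in the first part and a decreasing one in the second. -/
theorem exists_strictMonoOn_or_strictAntiOn (a b : ℕ) : ∃ K : ℕ, ∀ (f : ℕ → ℤ) (s : Finset ℕ),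
    Set.InjOn f s → K ≤ s.card →
      (∃ t ⊆ s, a ≤ t.card ∧ StrictMonoOn f t) ∨ ∃ t ⊆ s, b ≤ t.card ∧ StrictAntiOn f t := by
  induction a generalizing b with
  | zero => exact ⟨0, fun f s _ _ => Or.inl ⟨∅, by simp, by simp, by simp [StrictMonoOn]⟩⟩
  | succ a iha =>
    induction b with
    | zero => exact ⟨0, fun f s _ _ => Or.inr ⟨∅, by simp, by simp, by simp [StrictAntiOn]⟩⟩
    | succ b ihb =>
      obtain ⟨K, hK⟩ := iha (b + 1)
      obtain ⟨K', hK'⟩ := ihb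
      refine ⟨K + K' + 1, fun f s hf hs => ?_⟩
      have hne : s.Nonempty := Finset.card_pos.1 (by omega)
      set m := s.min' hne with hm
      have hms : m ∈ s := s.min'_mem hne
      have hlt : ∀ x ∈ s.erase m, m < x := fun x hx =>
        lt_of_le_of_ne (s.min'_le x (Finset.mem_of_mem_erase hx)) (Finset.ne_of_mem_erase hx).symm
      have hcard := Finset.card_filter_add_card_filter_not (s := s.erase m) (fun x => f m < f x)
      rw [Finset.card_erase_of_mem hms] at hcard
      rcases (by omega : K ≤ ((s.erase m).filter fun x => f m < f x).card ∨
        K' ≤ ((s.erase m).filter fun x => ¬ f m < f x).card) with h | h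
      · have hsub : ((s.erase m).filter fun x => f m < f x) ⊆ s :=
          (Finset.filter_subset _ _).trans (Finset.erase_subset _ _)
        rcases hK f _ (hf.mono (by exact_mod_cast hsub)) h with ⟨t, hts, htc, ht⟩ | ⟨t, hts, htc, ht⟩
        · left
          have hmt : m ∉ t := fun h => (hlt m (Finset.mem_filter.1 (hts h)).1).ne rfl
          refine ⟨insert m t, Finset.insert_subset hms (hts.trans hsub), ?_, ?_⟩
          · rw [Finset.card_insert_of_notMem hmt]; omega
          · intro x hx y hy hxy
            simp only [Finset.coe_insert, Set.mem_insert_iff, Finset.mem_coe] at hx hy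
            rcases hx with rfl | hx <;> rcases hy with rfl | hy
            · exact absurd hxy (lt_irrefl _)
            · exact (Finset.mem_filter.1 (hts hy)).2
            · exact absurd hxy (hlt x (Finset.mem_filter.1 (hts hx)).1).not_gt
            · exact ht hx hy hxy
        · exact Or.inr ⟨t, hts.trans hsub, htc, ht⟩
      · have hsub : ((s.erase m).filter fun x => ¬ f m < f x) ⊆ s :=
          (Finset.filter_subset _ _).trans (Finset.erase_subset _ _)
        rcases hK' f _ (hf.mono (by exact_mod_cast hsub)) h with ⟨t, hts, htc, ht⟩ | ⟨t, hts, htc, ht⟩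
        · exact Or.inl ⟨t, hts.trans hsub, htc, ht⟩
        · right
          have hmt : m ∉ t := fun h => (hlt m (Finset.mem_filter.1 (hts h)).1).ne rfl
          refine ⟨insert m t, Finset.insert_subset hms (hts.trans hsub), ?_, ?_⟩
          · rw [Finset.card_insert_of_notMem hmt]; omega
          · intro x hx y hy hxy
            simp only [Finset.coe_insert, Set.mem_insert_iff, Finset.mem_coe] at hx hy
            rcases hx with rfl | hx <;> rcases hy with rfl | hy
            · exact absurd hxy (lt_irrefl _)
            · obtain ⟨h1, h2⟩ := Finset.mem_filter.1 (hts hy)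
              refine lt_of_le_of_ne (not_lt.1 h2) fun he => ?_
              exact (hlt y h1).ne' (hf (Finset.mem_of_mem_erase h1) hms he)
            · exact absurd hxy (hlt x (Finset.mem_filter.1 (hts hx)).1).not_gt
            · exact ht hx hy hxy

/-- A sequence of points that goes to the right and alternates around a horizontal line, with
monotone upper and lower parts. -/
def Alternates (X Y : α → ℤ) (z : ℕ → α) (c d : Bool) (n : ℕ) : Prop :=
  ∀ i j, i < j → j < n → X (z i) < X (z j) ∧
    (i % 2 = 0 → j % 2 = 0 → Cmp c (Y (z i)) (Y (z j))) ∧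
    (i % 2 = 1 → j % 2 = 1 → Cmp d (Y (z i)) (Y (z j))) ∧
    (i % 2 = 0 → j % 2 = 1 → Y (z j) < Y (z i)) ∧
    (i % 2 = 1 → j % 2 = 0 → Y (z i) < Y (z j))

/-- Reversal keeps upper points at even indices because `n` is odd. -/
theorem Alternates.reverse {X Y : α → ℤ} {z : ℕ → α} {c d : Bool} {n : ℕ} (hn : n % 2 = 1)
    (h : Alternates X Y z c d n) :
    Alternates (fun a => -X a) Y (fun i => z (n - 1 - i)) (!c) (!d) n := by
  intro i j hij hj
  obtain ⟨h1, h2, h3, h4, h5⟩ := h (n - 1 - j) (n - 1 - i) (by omega) (by omega)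
  refine ⟨by simpa using h1, fun hi hj' => ?_, fun hi hj' => ?_, fun hi hj' => h5 (by omega) (by omega),
    fun hi hj' => h4 (by omega) (by omega)⟩
  · have := h2 (by omega) (by omega)
    cases c <;> simpa using this
  · have := h3 (by omega) (by omega)
    cases d <;> simpa using this

/-- A wedge opening to the right. -/
def Wedge (X Y : α → ℤ) (z : ℕ → α) (n : ℕ) : Prop :=
  ∀ i j, i < j → j < n → X (z i) < X (z j) ∧
    (j % 2 = 0 → Y (z i) < Y (z j)) ∧ (j % 2 = 1 → Y (z j) < Y (z i))

theorem Alternates.wedge {X Y : α → ℤ} {z : ℕ → α} {n : ℕ}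
    (h : Alternates X Y z true false n) : Wedge X Y z n := by
  intro i j hij hj
  obtain ⟨h1, h2, h3, h4, h5⟩ := h i j hij hj
  simp only [cmp_true, cmp_false] at h2 h3
  refine ⟨h1, fun h => ?_, fun h => ?_⟩ <;> rcases Nat.mod_two_eq_zero_or_one i with hi | hi <;> tauto

theorem Alternates.hasAlternation {X Y : α → ℤ} {z : ℕ → α} {n : ℕ}
    (h : Alternates X Y z true true n) : HasAlternation X Y n := by
  refine HasAlternation.of_base (baseValid_parKind n) (f := z) fun i j hij hj => ?_
  obtain ⟨h1, h2, h3, h4, h5⟩ := h i j hij hj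
  rcases Nat.mod_two_eq_zero_or_one i with hi | hi <;>
    rcases Nat.mod_two_eq_zero_or_one j with hj' | hj' <;>
    simp_all [parKind, baseX, baseY]

/-- Points `x e` and `y e` that alternate around a horizontal line. -/
theorem exists_alternates (N : ℕ) : ∃ K : ℕ, ∀ (α : Type) (X Y : α → ℤ) (x y : ℕ → α) (s : Finset ℕ),
    K ≤ s.card → Function.Injective Y →
    (∀ e ∈ s, X (x e) < X (y e)) → (∀ e ∈ s, ∀ e' ∈ s, e < e' → X (y e) < X (x e')) →
    (∀ e ∈ s, ∀ e' ∈ s, Y (y e) < Y (x e')) →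
    ∃ z c d, Alternates X Y z c d N := by
  -- Erdős–Szekeres is applied twice: `K₂` indices leave `K₁` on which the upper points are
  -- monotone, and these leave `N` on which the lower points are monotone as well.
  obtain ⟨K₁, hK₁⟩ := exists_strictMonoOn_or_strictAntiOn N N
  obtain ⟨K₂, hK₂⟩ := exists_strictMonoOn_or_strictAntiOn K₁ K₁
  refine ⟨K₂, fun α X Y x y s hs hY h1 h2 h3 => ?_⟩
  have mono : ∀ (K : ℕ) (w : ℕ → α) (s : Finset ℕ), ((∃ t ⊆ s, K ≤ t.card ∧
      StrictMonoOn (fun e => Y (w e)) t) ∨ ∃ t ⊆ s, K ≤ t.card ∧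
      StrictAntiOn (fun e => Y (w e)) t) → ∃ t ⊆ s, K ≤ t.card ∧ ∃ c, ∀ e ∈ t, ∀ e' ∈ t, e < e' →
        Cmp c (Y (w e)) (Y (w e')) := by
    rintro K w s (⟨t, hts, htc, ht⟩ | ⟨t, hts, htc, ht⟩)
    · exact ⟨t, hts, htc, true, fun e he e' he' hee => ht he he' hee⟩
    · exact ⟨t, hts, htc, false, fun e he e' he' hee => ht he he' hee⟩
  have hxinj : ∀ e ∈ s, ∀ e' ∈ s, e < e' → X (x e) < X (x e') := fun e he e' he' hlt =>
    (h1 e he).trans (h2 e he e' he' hlt)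
  have hyinj : ∀ e ∈ s, ∀ e' ∈ s, e < e' → X (y e) < X (y e') := fun e he e' he' hlt =>
    (h2 e he e' he' hlt).trans (h1 e' he')
  have inj : ∀ (w : ℕ → α), (∀ e ∈ s, ∀ e' ∈ s, e < e' → X (w e) < X (w e')) →
      Set.InjOn (fun e => Y (w e)) s := by
    intro w hw e he e' he' hee
    have := hY hee
    rcases lt_trichotomy e e' with h | h | h
    · exact absurd (congrArg X this) (hw e he e' he' h).ne
    · exact h
    · exact absurd (congrArg X this) (hw e' he' e he h).ne'
  obtain ⟨t₁, ht₁s, ht₁c, c, hc⟩ := mono K₁ x s (hK₂ _ s (inj x hxinj) hs)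
  obtain ⟨t, hts, htc, d, hd⟩ := mono N y t₁ (hK₁ _ t₁ ((inj y hyinj).mono (by exact_mod_cast ht₁s)) ht₁c)
  obtain ⟨t', ht't, ht'c⟩ := Finset.exists_subset_card_eq htc
  have hmem : ∀ k (hk : k < N), t'.orderEmbOfFin ht'c ⟨k, hk⟩ ∈ t := fun k hk =>
    ht't (t'.orderEmbOfFin_mem ht'c _)
  have hlt : ∀ k k' (hk : k < N) (hk' : k' < N), k < k' →
      t'.orderEmbOfFin ht'c ⟨k, hk⟩ < t'.orderEmbOfFin ht'c ⟨k', hk'⟩ := fun k k' hk hk' h => by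
    simpa using h
  generalize (t'.orderEmbOfFin ht'c : Fin N → ℕ) = φ at hmem hlt
  set ψ : ℕ → ℕ := fun k => if hk : k < N then φ ⟨k, hk⟩ else 0 with hψ
  have hmem' : ∀ k < N, ψ k ∈ t := fun k hk => by simpa [hψ, hk] using hmem k hk
  have hlt' : ∀ k k', k < k' → k' < N → ψ k < ψ k' := fun k k' h hk' => by
    simpa [hψ, hk', h.trans hk'] using hlt k k' (h.trans hk') hk' h
  refine ⟨fun i => if i % 2 = 0 then x (ψ (i / 2)) else y (ψ (i / 2)), c, d, fun i j hij hj => ?_⟩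
  have hi2 : i / 2 < N := by omega
  have hj2 : j / 2 < N := by omega
  have mi := hmem' _ hi2
  have mj := hmem' _ hj2
  have mi₁ := hts mi
  have mj₁ := hts mj
  have mis := ht₁s mi₁
  have mjs := ht₁s mj₁
  rcases Nat.mod_two_eq_zero_or_one i with hi' | hi' <;>
    rcases Nat.mod_two_eq_zero_or_one j with hj' | hj' <;> simp only [hi', hj']
  · have hl := hlt' (i / 2) (j / 2) (by omega) hj2
    simpa using ⟨hxinj _ mis _ mjs hl, hc _ mi₁ _ mj₁ hl⟩
  · have hX : X (x (ψ (i / 2))) < X (y (ψ (j / 2))) := by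
      rcases Nat.eq_or_lt_of_le (Nat.div_le_div_right (c := 2) hij.le) with h | h
      · rw [h]; exact h1 _ mjs
      · exact (hxinj _ mis _ mjs (hlt' _ _ h hj2)).trans (h1 _ mjs)
    simpa using ⟨hX, h3 _ mjs _ mis⟩
  · have hl := hlt' (i / 2) (j / 2) (by omega) hj2
    simpa using ⟨h2 _ mis _ mjs hl, h3 _ mis _ mjs⟩
  · have hl := hlt' (i / 2) (j / 2) (by omega) hj2
    simpa using ⟨hyinj _ mis _ mjs hl, hd _ mi _ mj hl⟩

/-- Equal directions of the two sides give a parallel alternation, opposite ones a wedge; a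
reflection of the horizontal axis settles the two cases in which the upper side falls. -/
theorem Alternates.hasAlternation_or_wedge {X Y : α → ℤ} {z : ℕ → α} {c d : Bool} {n : ℕ}
    (hn : n % 2 = 1) (h : Alternates X Y z c d n) :
    HasAlternation X Y n ∨ ∃ g z, Wedge (symX g X Y) (symY g X Y) z n := by
  cases c <;> cases d
  · exact Or.inl (HasAlternation.of_sym (false, true, false) (h.reverse hn).hasAlternation)
  · exact Or.inr ⟨(false, true, false), _, (h.reverse hn).wedge⟩
  · exact Or.inr ⟨(false, false, false), _, h.wedge⟩
  · exact Or.inl h.hasAlternation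

/-! ### Simplicity and closures -/

/-- `p` lies strictly between two points of `S`, horizontally or vertically. -/
def Cuts (X Y : α → ℤ) (S : Set α) (p : α) : Prop :=
  ∃ a ∈ S, ∃ b ∈ S, X a < X p ∧ X p < X b ∨ Y a < Y p ∧ Y p < Y b

/-- The point set `Q` is simple: a subset with two elements that no other point cuts is all of
`Q`. -/
def SimpleOn (X Y : α → ℤ) (Q : Set α) : Prop :=
  ∀ S ⊆ Q, S.Nontrivial → (∀ p ∈ Q, Cuts X Y S p → p ∈ S) → S = Q

/-- The points that are weakly between points of `S` in the coordinate `C`. -/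
def hull (C : α → ℤ) (S : Set α) : Set α := {p | ∃ a ∈ S, ∃ b ∈ S, C a ≤ C p ∧ C p ≤ C b}

theorem subset_hull (C : α → ℤ) (S : Set α) : S ⊆ hull C S := fun a ha => ⟨a, ha, a, ha, le_rfl, le_rfl⟩

theorem mem_hull_of_between {C : α → ℤ} {S : Set α} {a b p : α} (ha : a ∈ hull C S)
    (hb : b ∈ hull C S) (h1 : C a ≤ C p) (h2 : C p ≤ C b) : p ∈ hull C S := by
  obtain ⟨a', ha', _, _, h3, _⟩ := ha
  obtain ⟨_, _, b', hb', _, h4⟩ := hb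
  exact ⟨a', ha', b', hb', h3.trans h1, h2.trans h4⟩

theorem cmp_of_notMem_hull {C : α → ℤ} {S : Set α} {q : α} (hq : q ∉ hull C S) :
    ∃ c, ∀ p ∈ S, Cmp c (C p) (C q) := by
  by_cases h : ∃ p ∈ S, C p ≤ C q
  · obtain ⟨p, hp, hpq⟩ := h
    refine ⟨true, fun r hr => ?_⟩
    simp only [cmp_true]
    by_contra hcon
    exact hq ⟨p, hp, r, hr, hpq, not_lt.1 hcon⟩
  · push Not at h
    exact ⟨false, h⟩

/-- The coordinate used in step `n` of the closure process. -/
def coord (X Y : α → ℤ) (n : ℕ) : α → ℤ := if n % 2 = 0 then Y else X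

theorem coord_add_two (X Y : α → ℤ) (n : ℕ) : coord X Y (n + 2) = coord X Y n := by
  simp [coord]

/-- Starting from `S`, take vertical and horizontal hulls in turn. -/
def closureSeq (X Y : α → ℤ) (S : Set α) : ℕ → Set α
  | 0 => S
  | n + 1 => hull (coord X Y n) (closureSeq X Y S n)

theorem closureSeq_mono (X Y : α → ℤ) (S : Set α) : Monotone (closureSeq X Y S) :=
  monotone_nat_of_le_succ fun _ => subset_hull _ _

/-- Stage `n + 1` is a hull, hence convex in the coordinate just used. If the next step adds
nothing, it is convex in the other coordinate too, so no point cuts it and simplicity applies. -/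
theorem closureSeq_eq_univ {X Y : α → ℤ} {S : Set α} (hXY : SimpleOn X Y Set.univ)
    (hS : S.Nontrivial) (n : ℕ) (h : closureSeq X Y S (n + 2) ⊆ closureSeq X Y S (n + 1)) :
    closureSeq X Y S (n + 1) = Set.univ := by
  refine hXY _ (Set.subset_univ _) (hS.mono (closureSeq_mono X Y S (Nat.zero_le _))) ?_
  rintro p - ⟨a, ha, b, hb, hab⟩
  have h1 : ∀ a ∈ closureSeq X Y S (n + 1), ∀ b ∈ closureSeq X Y S (n + 1),
      coord X Y (n + 1) a ≤ coord X Y (n + 1) p → coord X Y (n + 1) p ≤ coord X Y (n + 1) b →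
      p ∈ closureSeq X Y S (n + 1) := fun a ha b hb h1 h2 => h ⟨a, ha, b, hb, h1, h2⟩
  have h2 : ∀ a ∈ closureSeq X Y S (n + 1), ∀ b ∈ closureSeq X Y S (n + 1),
      coord X Y n a ≤ coord X Y n p → coord X Y n p ≤ coord X Y n b →
      p ∈ closureSeq X Y S (n + 1) := fun a ha b hb h1 h2 => mem_hull_of_between ha hb h1 h2
  rcases Nat.mod_two_eq_zero_or_one n with hn | hn
  · have hn' : (n + 1) % 2 = 1 := by omega
    simp only [coord, hn, hn', if_true, one_ne_zero, if_false] at h1 h2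
    rcases hab with ⟨h3, h4⟩ | ⟨h3, h4⟩
    · exact h1 a ha b hb h3.le h4.le
    · exact h2 a ha b hb h3.le h4.le
  · have hn' : (n + 1) % 2 = 0 := by omega
    simp only [coord, hn, hn', if_true, one_ne_zero, if_false] at h1 h2
    rcases hab with ⟨h3, h4⟩ | ⟨h3, h4⟩
    · exact h2 a ha b hb h3.le h4.le
    · exact h1 a ha b hb h3.le h4.le

/-- The points `f 0, …, f m` form a pin sequence, `c` giving the sides of the pins. -/
def PinSeq (X Y : α → ℤ) (c : ℕ → Bool) (f : ℕ → α) (m : ℕ) : Prop :=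
  ∀ i j, i < j → j ≤ m → Cmp (c j) (coord X Y j (f i)) (coord X Y j (f j)) ∧
    Cmp (decide (j = i + 1) ^^ c (j - 1)) (coord X Y (j + 1) (f i)) (coord X Y (j + 1) (f j))

/-- The pins are found backwards from `q`, one for each stage. The index starts at stage 2 because
the argument needs the preceding stage to be convex in one coordinate, which stage 0 need not be.
The last clause is carried along to identify the side of the previous pin. -/
theorem exists_pinSeq {X Y : α → ℤ} (hX : Function.Injective X) (hY : Function.Injective Y)
    {S : Set α} (hS : S.Nonempty) (m : ℕ) : ∀ q ∈ closureSeq X Y S (m + 2), q ∉ closureSeq X Y S (m + 1) →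
      ∃ f c, f m = q ∧ (∀ i ≤ m, f i ∈ closureSeq X Y S (i + 2)) ∧ PinSeq X Y c f m ∧
        ∀ p ∈ closureSeq X Y S (m + 1), Cmp (c m) (coord X Y m p) (coord X Y m q) := by
  have hC : ∀ n, Function.Injective (coord X Y n) := fun n => by
    unfold coord; split_ifs <;> assumption
  have side : ∀ n q, q ∉ closureSeq X Y S (n + 1) →
      ∃ e, ∀ p ∈ closureSeq X Y S (n + 1), Cmp e (coord X Y n p) (coord X Y n q) := fun n q hq => by
    refine cmp_of_notMem_hull fun hq' => hq ?_
    obtain ⟨a, ha, b, hb, h1, h2⟩ := hq'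
    exact mem_hull_of_between ha hb h1 h2
  induction m with
  | zero =>
    intro q hq hq'
    obtain ⟨e, he⟩ := side 0 q hq'
    exact ⟨fun _ => q, fun _ => e, rfl, fun i hi => by rwa [Nat.le_zero.1 hi],
      fun i j hij hj => by omega, he⟩
  | succ m ih =>
    intro q hq hq'
    obtain ⟨e', he'⟩ := side (m + 1) q hq'
    have hqm : q ∉ closureSeq X Y S (m + 1) := fun h =>
      hq' (closureSeq_mono X Y S (Nat.le_succ (m + 1)) h)
    obtain ⟨e, he⟩ := side m q hqm
    obtain ⟨a, ha, b, hb, h1, h2⟩ := hq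
    rw [coord_add_two] at h1 h2
    -- In coordinate `m` the point `q` lies on side `e` of stage `m + 1`, yet it belongs to the hull
    -- of stage `m + 2`. So stage `m + 2` has a point `d` beyond `q` on that side; it is new there
    -- and serves as the previous pin, which `q` separates from everything earlier.
    have hd : ∃ d ∈ closureSeq X Y S (m + 2), Cmp (!e) (coord X Y m d) (coord X Y m q) := by
      cases e
      · refine ⟨a, ha, lt_of_le_of_ne h1 fun h => hq' ?_⟩
        rwa [← hC m h]
      · refine ⟨b, hb, lt_of_le_of_ne h2 fun h => hq' ?_⟩
        rwa [hC m h]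
    obtain ⟨d, hd, hdq⟩ := hd
    have hd' : d ∉ closureSeq X Y S (m + 1) := fun h => by
      have := he d h
      cases e <;> simp at this hdq <;> omega
    obtain ⟨f, c, hfm, hf, hpin, hc⟩ := ih d hd hd'
    -- Seen from any point of `S`, both `q` and the more distant `d` lie on side `e`.
    have hce : c m = e := by
      obtain ⟨p, hp⟩ := hS
      have hp' := closureSeq_mono X Y S (Nat.zero_le (m + 1)) hp
      have h3 := hc p hp'
      have h4 := he p hp'
      revert h3 h4 hdq
      cases c m <;> cases e <;> simp <;> omega
    refine ⟨fun i => if i ≤ m then f i else q, fun i => if i ≤ m then c i else e', by simp, ?_, ?_, ?_⟩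
    · intro i hi
      by_cases him : i ≤ m
      · simpa [him] using hf i him
      · obtain rfl : i = m + 1 := by omega
        simpa using ⟨a, ha, b, hb, by rwa [coord_add_two], by rwa [coord_add_two]⟩
    · intro i j hij hj
      by_cases hjm : j ≤ m
      · have him : i ≤ m := by omega
        have hjm' : j - 1 ≤ m := by omega
        simpa [hjm, him, hjm'] using hpin i j hij hjm
      · obtain rfl : j = m + 1 := by omega
        have him : i ≤ m := by omega
        simp only [him, if_true, add_tsub_cancel_right, le_refl, Nat.not_succ_le_self, if_false,
          coord_add_two, hce]
        refine ⟨he' _ (closureSeq_mono X Y S (by omega) (hf i him)), ?_⟩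
        rcases Nat.eq_or_lt_of_le him with rfl | him'
        · simpa [hfm] using hdq
        · have : m ≠ i := by omega
          simpa [this] using he _ (closureSeq_mono X Y S (by omega) (hf i him))
    · intro p hp
      simpa using he' p hp

/-- Some valid word of length `N` consisting of pin letters is realized. -/
def HasPins (X Y : α → ℤ) (N : ℕ) : Prop :=
  ∃ u f, (∀ i, (u i).2 = 7) ∧ Valid u N ∧ Realizes X Y u f N

theorem PinSeq.hasPins {X Y : α → ℤ} {c : ℕ → Bool} {f : ℕ → α} {m : ℕ} (h : PinSeq X Y c f m) :
    HasPins X Y (m + 1) := by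
  -- Odd steps use `X`, so odd pins are horizontal. For `i = 0` the bit `c (i - 1)` is a dummy: the
  -- first letter is never compared with an earlier one.
  refine ⟨fun i => ((decide (i % 2 = 1), c (i - 1), c i), 7), f, fun _ => rfl,
    ⟨by simp [baseStart], fun i _ => ?_⟩, fun i j hij hj => ?_⟩
  · rcases Nat.mod_two_eq_zero_or_one i with h | h
    · simp [letterNext, h, Nat.add_mod]
    · simp [letterNext, h, Nat.add_mod]
  · obtain ⟨h1, h2⟩ := h i j hij (by omega)
    rcases Nat.mod_two_eq_zero_or_one j with hj' | hj'
    · have : (j + 1) % 2 = 1 := by omega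
      simp only [coord, hj', this, if_true, one_ne_zero, if_false] at h1 h2
      simpa [letterX, letterY, hj'] using ⟨h2, h1⟩
    · have : (j + 1) % 2 = 0 := by omega
      simp only [coord, hj', this, if_true, one_ne_zero, if_false] at h1 h2
      simpa [letterX, letterY, hj'] using ⟨h1, h2⟩

theorem closureSeq_eq_univ_of_not_hasPins {X Y : α → ℤ} (hX : Function.Injective X)
    (hY : Function.Injective Y) (hXY : SimpleOn X Y Set.univ) {N : ℕ} (hN : ¬ HasPins X Y (N + 1))
    {S : Set α} (hS : S.Nontrivial) : closureSeq X Y S (N + 1) = Set.univ := by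
  refine closureSeq_eq_univ hXY hS N fun q hq => ?_
  by_contra hq'
  obtain ⟨f, c, -, -, h, -⟩ := exists_pinSeq hX hY hS.nonempty N q hq hq'
  exact hN h.hasPins

/-! ### Wedges -/

/-- `S` lies to the left of the point `z k` of a wedge and vertically within the rest of it. -/
def InMouth (X Y : α → ℤ) (z : ℕ → α) (k : ℕ) (S : Set α) : Prop :=
  ∀ p ∈ S, X p < X (z k) ∧ min (Y (z k)) (Y (z (k + 1))) < Y p ∧ Y p < max (Y (z k)) (Y (z (k + 1)))

/-- A vertical reflection exchanges upper and lower points; dropping the first point restores the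
parity convention. -/
theorem wedge_neg {X Y : α → ℤ} {z : ℕ → α} {n : ℕ} (h : Wedge X Y z n) :
    Wedge X (fun a => -Y a) (fun i => z (i + 1)) (n - 1) := by
  intro i j hij hj
  obtain ⟨h1, h2, h3⟩ := h (i + 1) (j + 1) (by omega) (by omega)
  exact ⟨h1, fun hj => neg_lt_neg (h3 (by omega)), fun hj => neg_lt_neg (h2 (by omega))⟩

theorem Wedge.hasAlternation_mouth {X Y : α → ℤ} {z : ℕ → α} {n : ℕ} (h : Wedge X Y z n) {k m : ℕ}
    (hk : k % 2 = 0) (hm : k + m ≤ n) {q : α} (hX : ∀ i < m, X (z (k + i)) < X q)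
    (hY : ∀ i < m, ((k + i) % 2 = 0 → Y q < Y (z (k + i))) ∧ ((k + i) % 2 = 1 → Y (z (k + i)) < Y q)) :
    HasAlternation X Y (m + 1) := by
  refine HasAlternation.of_base (baseValid_mouthKind _)
    (f := fun i => if i = 0 then q else z (k + (i - 1))) fun i j hij hj => ?_
  obtain ⟨j, rfl⟩ : ∃ j', j = j' + 1 := ⟨j - 1, by omega⟩
  rcases Nat.eq_zero_or_pos i with rfl | hi
  · rcases Nat.mod_two_eq_zero_or_one j with hj' | hj'
    · have e1 : (j + 1) % 2 = 1 := by omega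
      have := (hY j (by omega)).1 (by omega)
      simpa [mouthKind, baseX, baseY, e1, this] using hX j (by omega)
    · have e1 : (j + 1) % 2 = 0 := by omega
      have := (hY j (by omega)).2 (by omega)
      simpa [mouthKind, baseX, baseY, e1, this] using hX j (by omega)
  · obtain ⟨i, rfl⟩ : ∃ i', i = i' + 1 := ⟨i - 1, by omega⟩
    obtain ⟨h1, h2, h3⟩ := h (k + i) (k + j) (by omega) (by omega)
    rcases Nat.mod_two_eq_zero_or_one j with hj' | hj'
    · have e1 : (j + 1) % 2 = 1 := by omega
      have := h2 (by omega)
      rcases Nat.mod_two_eq_zero_or_one i with hi' | hi'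
      · have e2 : (i + 1) % 2 = 1 := by omega
        simpa [mouthKind, baseX, baseY, e1, e2, this] using h1
      · have e2 : (i + 1) % 2 = 0 := by omega
        simpa [mouthKind, baseX, baseY, e1, e2, this] using h1
    · have e1 : (j + 1) % 2 = 0 := by omega
      have := h3 (by omega)
      rcases Nat.mod_two_eq_zero_or_one i with hi' | hi'
      · have e2 : (i + 1) % 2 = 1 := by omega
        simpa [mouthKind, baseX, baseY, e1, e2, this] using h1
      · have e2 : (i + 1) % 2 = 0 := by omega
        simpa [mouthKind, baseX, baseY, e1, e2, this] using h1

theorem Wedge.hasAlternation_tip {X Y : α → ℤ} {z : ℕ → α} {n : ℕ} (h : Wedge X Y z n) {k m : ℕ}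
    (hk : k % 2 = 0) (hm : k + m ≤ n) {p r : α} (hpr : X p < X r) (hpr' : Y p < Y r)
    (hX : ∀ i < m, X r < X (z (k + i))) (hr : ∀ i < m, Y (z (k + i)) < Y r)
    (hY : ∀ i < m, ((k + i) % 2 = 0 → Y p < Y (z (k + i))) ∧ ((k + i) % 2 = 1 → Y (z (k + i)) < Y p)) :
    HasAlternation X Y (m + 2) := by
  refine HasAlternation.of_base (baseValid_tipKind _)
    (f := fun i => if i = 0 then p else if i = 1 then r else z (k + (i - 2))) fun i j hij hj => ?_
  rcases Nat.eq_or_lt_of_le (show 1 ≤ j by omega) with rfl | hj1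
  · obtain rfl : i = 0 := by omega
    simpa [tipKind, baseX, baseY] using ⟨hpr, hpr'⟩
  obtain ⟨j, rfl⟩ : ∃ j', j = j' + 2 := ⟨j - 2, by omega⟩
  have e0 : j + 2 ≠ 1 := by omega
  have hXr := hX j (by omega)
  rcases Nat.eq_zero_or_pos i with rfl | hi
  · have hpz := hpr.trans hXr
    rcases Nat.mod_two_eq_zero_or_one j with hj' | hj'
    · have := (hY j (by omega)).1 (by omega)
      simpa [tipKind, baseX, baseY, hj', this] using hpz
    · have := (hY j (by omega)).2 (by omega)
      simpa [tipKind, baseX, baseY, hj', this] using hpz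
  rcases Nat.eq_or_lt_of_le (show 1 ≤ i by omega) with rfl | hi1
  · have hYr := hr j (by omega)
    rcases Nat.mod_two_eq_zero_or_one j with hj' | hj' <;>
      simpa [tipKind, baseX, baseY, hj', hYr] using hXr
  obtain ⟨i, rfl⟩ : ∃ i', i = i' + 2 := ⟨i - 2, by omega⟩
  obtain ⟨h1, h2, h3⟩ := h (k + i) (k + j) (by omega) (by omega)
  rcases Nat.mod_two_eq_zero_or_one j with hj' | hj'
  · have := h2 (by omega)
    rcases Nat.mod_two_eq_zero_or_one i with hi' | hi' <;>
      simpa [tipKind, baseX, baseY, hj', hi', this] using h1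
  · have := h3 (by omega)
    rcases Nat.mod_two_eq_zero_or_one i with hi' | hi' <;>
      simpa [tipKind, baseX, baseY, hj', hi', this] using h1

/-- Later wedge points only move outwards, so the two points that bound `S` control all the
following ones. -/
theorem InMouth.wedge {X Y : α → ℤ} {z : ℕ → α} {n : ℕ} (h : Wedge X Y z n) {k : ℕ} {S : Set α}
    (hS : InMouth X Y z k S) {p : α} (hp : p ∈ S) {i : ℕ} (hki : k ≤ i) (hi : i + 1 < n) :
    X p < X (z i) ∧ (i % 2 = 0 → Y p < Y (z i)) ∧ (i % 2 = 1 → Y (z i) < Y p) := by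
  obtain ⟨h1, h2, h3⟩ := hS p hp
  have h6 := h k (k + 1) (by omega) (by omega)
  rcases Nat.eq_or_lt_of_le hki with rfl | hlt
  · refine ⟨h1, fun h => ?_, fun h => ?_⟩ <;> omega
  · have h4 := h k i hlt (by omega)
    rcases Nat.eq_or_lt_of_le (show k + 1 ≤ i from hlt) with rfl | hlt'
    · refine ⟨h1.trans h4.1, fun h => ?_, fun h => ?_⟩ <;> omega
    · have h5 := h (k + 1) i hlt' (by omega)
      refine ⟨h1.trans h4.1, fun h => ?_, fun h => ?_⟩ <;> omega

theorem HasAlternation.mono {X Y : α → ℤ} {N N' : ℕ} (hN : N ≤ N') (h : HasAlternation X Y N') :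
    HasAlternation X Y N := by
  obtain ⟨g, t, f, ⟨h1, h2, h3⟩, hr⟩ := h
  exact ⟨g, t, f, ⟨h1, h2, fun i hi => h3 i (by omega)⟩, fun i j hij hj => hr i j hij (by omega)⟩

/-- A point `r` that escapes past `m + 1` wedge points in one hull step is confined in one
coordinate. After a horizontal hull it is still left of the wedge, so it lies above or below a long
piece of it and forms the tip with a point `a` of `S`. After a vertical hull it is still between the
two sides, so it lies far to the right, in the mouth. -/
theorem Wedge.hasAlternation_of_jump {X Y : α → ℤ} {z : ℕ → α} {n : ℕ} (h : Wedge X Y z n)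
    (hXinj : Function.Injective X) {S S' : Set α} {k m : ℕ}
    (hSS' : S' ⊆ hull X S ∨ S' ⊆ hull Y S) (hS : InMouth X Y z k S)
    (hS' : ¬ InMouth X Y z (k + m + 1) S') (hn : k + m + 2 < n) : HasAlternation X Y (m + 1) := by
  unfold InMouth at hS'
  rw [show k + m + 1 + 1 = k + m + 2 from rfl] at hS'
  push Not at hS'
  obtain ⟨r, hr, hr'⟩ := hS'
  have hK := h (k + m + 1) (k + m + 2) (by omega) (by omega)
  have hlt : ∀ i < k + m + 1, X (z i) < X (z (k + m + 1)) ∧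
      Y (z i) < max (Y (z (k + m + 1))) (Y (z (k + m + 2))) ∧
      min (Y (z (k + m + 1))) (Y (z (k + m + 2))) < Y (z i) := fun i hi => by
    have h1 := h i (k + m + 1) (by omega) (by omega)
    have h2 := h i (k + m + 2) (by omega) (by omega)
    rcases Nat.mod_two_eq_zero_or_one (k + m + 1) with hp | hp <;> refine ⟨h1.1, ?_, ?_⟩ <;> omega
  -- Both wedge families begin their wedge with an upper point, hence the even index.
  obtain ⟨k', hk', hkk', hk'k⟩ : ∃ k', k' % 2 = 0 ∧ k ≤ k' ∧ k' ≤ k + 1 := by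
    rcases Nat.mod_two_eq_zero_or_one k with hp | hp
    · exact ⟨k, hp, le_rfl, by omega⟩
    · exact ⟨k + 1, by omega, by omega, le_rfl⟩
  rcases hSS' with hSS' | hSS'
  · obtain ⟨a, ha, b, hb, h1, h2⟩ := hSS' hr
    have hXr : ∀ i, k ≤ i → i + 1 < n → X r < X (z i) := fun i hki hi =>
      h2.trans_lt (hS.wedge h hb hki hi).1
    have hYr := hr' (hXr _ (by omega) (by omega))
    have haK := hS.wedge h ha (show k ≤ k + m + 1 by omega) (by omega)
    have haK' := hS a ha
    -- Equality would make `r` a point of `S`, which has not escaped.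
    have har : X a < X r := by
      refine lt_of_le_of_ne h1 fun he => ?_
      obtain rfl := hXinj he
      have ek := hlt k (by omega)
      have ek1 : Y (z (k + 1)) ≤ max (Y (z (k + m + 1))) (Y (z (k + m + 2))) ∧
          min (Y (z (k + m + 1))) (Y (z (k + m + 2))) ≤ Y (z (k + 1)) := by
        rcases Nat.eq_zero_or_pos m with rfl | hm
        · simp
        · exact ⟨(hlt (k + 1) (by omega)).2.1.le, (hlt (k + 1) (by omega)).2.2.le⟩
      have e3 := hYr (by omega)
      omega
    by_cases hmin : min (Y (z (k + m + 1))) (Y (z (k + m + 2))) < Y r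
    · have hmax := hYr hmin
      have hzr : ∀ i < k + m + 1, Y (z i) < Y r := fun i hi => (hlt i hi).2.1.trans_le hmax
      refine HasAlternation.mono (Nat.le_succ _) (h.hasAlternation_tip hk' (m := m) (by omega) har ?_
        (fun i hi => hXr _ (by omega) (by omega)) (fun i hi => hzr _ (by omega))
        fun i hi => (hS.wedge h ha (by omega) (by omega)).2)
      have e1 := hS.wedge h ha hkk' (by omega)
      rcases Nat.eq_or_lt_of_le (show k' ≤ k + m + 1 by omega) with he | hl
      · have e2 : Y (z (k + m + 1)) ≤ Y r := (le_max_left _ _).trans hmax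
        rw [← he] at e2
        exact (e1.2.1 hk').trans_le e2
      · exact (e1.2.1 hk').trans (hzr k' hl)
    -- Here `r` lies below the wedge. After reflecting with `wedge_neg`, index `k''` stands for the
    -- original index `k'' + 1`.
    · obtain ⟨k'', hk'', hkk'', hk''k⟩ : ∃ k'', k'' % 2 = 0 ∧ k ≤ k'' + 1 ∧ k'' ≤ k := by
        rcases Nat.mod_two_eq_zero_or_one k with hp | hp
        · exact ⟨k, hp, by omega, by omega⟩
        · exact ⟨k - 1, by omega, by omega, by omega⟩
      have hmin' := not_lt.1 hmin
      have hzr : ∀ i < k + m + 1, Y r < Y (z i) := fun i hi => hmin'.trans_lt (hlt i hi).2.2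
      refine HasAlternation.of_sym (false, false, true) ?_
      refine HasAlternation.mono (Nat.le_succ _) ((wedge_neg h).hasAlternation_tip hk'' (m := m)
        (by omega) har ?_ (fun i hi => hXr _ (by omega) (by omega))
        (fun i hi => neg_lt_neg (hzr _ (by omega))) fun i hi => ?_)
      · refine neg_lt_neg ?_
        have e1 := hS.wedge h ha hkk'' (by omega)
        rcases Nat.eq_or_lt_of_le (show k'' + 1 ≤ k + m + 1 by omega) with he | hl
        · have e2 : Y r ≤ Y (z (k + m + 1)) := hmin'.trans (min_le_left _ _)
          rw [← he] at e2
          exact e2.trans_lt (e1.2.2 (by omega))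
        · exact (hzr _ hl).trans (e1.2.2 (by omega))
      · have e1 := hS.wedge h ha (i := k'' + i + 1) (by omega) (by omega)
        exact ⟨fun hp => neg_lt_neg (e1.2.2 (by omega)), fun hp => neg_lt_neg (e1.2.1 (by omega))⟩
  · obtain ⟨a, ha, b, hb, h1, h2⟩ := hSS' hr
    have hYr : ∀ i, k ≤ i → i + 1 < n →
        (i % 2 = 0 → Y r < Y (z i)) ∧ (i % 2 = 1 → Y (z i) < Y r) := fun i hki hi =>
      ⟨fun hp => h2.trans_lt ((hS.wedge h hb hki hi).2.1 hp),
        fun hp => ((hS.wedge h ha hki hi).2.2 hp).trans_le h1⟩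
    have hXr : X (z (k + m + 1)) ≤ X r := by
      by_contra hcon
      have e1 := hr' (not_le.1 hcon)
      have e2 := hYr (k + m + 1) (by omega) (by omega)
      have ea := hS a ha
      have eb := hS b hb
      have ek := hlt k (by omega)
      have ek1 : Y (z (k + 1)) ≤ max (Y (z (k + m + 1))) (Y (z (k + m + 2))) ∧
          min (Y (z (k + m + 1))) (Y (z (k + m + 2))) ≤ Y (z (k + 1)) := by
        rcases Nat.eq_zero_or_pos m with rfl | hm
        · simp
        · exact ⟨(hlt (k + 1) (by omega)).2.1.le, (hlt (k + 1) (by omega)).2.2.le⟩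
      have e3 := e1 (by omega)
      omega
    exact h.hasAlternation_mouth hk' (m := m) (by omega)
      (fun i hi => (hlt _ (by omega)).1.trans_le hXr) fun i hi => hYr _ (by omega) (by omega)

/-- Without a jump, each step moves the mouth bound by at most `m + 1` indices. After `t` steps the
whole point set would lie strictly to the left of a wedge point, and so would that point itself. -/
theorem Wedge.hasAlternation_of_closure {X Y : α → ℤ} {z : ℕ → α} {n : ℕ} (h : Wedge X Y z n)
    (hXinj : Function.Injective X) {S : ℕ → Set α} {t m : ℕ}
    (hS : ∀ s, S (s + 1) ⊆ hull X (S s) ∨ S (s + 1) ⊆ hull Y (S s)) (hS0 : S 0 ⊆ {z 0, z 1})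
    (hSt : S t = Set.univ) (hn : 2 + t * (m + 1) + 1 < n) : HasAlternation X Y (m + 1) := by
  by_contra hcon
  have key : ∀ s ≤ t, InMouth X Y z (2 + s * (m + 1)) (S s) := by
    intro s
    induction s with
    | zero =>
      intro _ p hp
      have h02 := h 0 2 (by omega) (by omega)
      have h12 := h 1 2 (by omega) (by omega)
      have h03 := h 0 3 (by omega) (by omega)
      have h13 := h 1 3 (by omega) (by omega)
      simp only [zero_mul, add_zero]
      rcases hS0 hp with rfl | rfl <;> refine ⟨by omega, ?_, ?_⟩ <;> simp <;> omega
    | succ s ih =>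
      intro hs
      by_contra hcon'
      have hle : (s + 1) * (m + 1) ≤ t * (m + 1) := Nat.mul_le_mul_right _ hs
      have he : 2 + (s + 1) * (m + 1) = 2 + s * (m + 1) + m + 1 := by ring
      rw [he] at hcon'
      exact hcon (h.hasAlternation_of_jump hXinj (hS s) (ih (by omega)) hcon' (by omega))
  have h1 := key t le_rfl (z (2 + t * (m + 1))) (hSt ▸ Set.mem_univ _)
  exact lt_irrefl _ h1.1

/-- The wedge lives in transformed coordinates while the closure process uses the original ones;
hulls only see the axes up to exchange and sign. -/
theorem hull_symX_or (g : Bool × Bool × Bool) (X Y : α → ℤ) (S : Set α) :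
    (hull X S ⊆ hull (symX g X Y) S ∨ hull X S ⊆ hull (symY g X Y) S) ∧
    (hull Y S ⊆ hull (symX g X Y) S ∨ hull Y S ⊆ hull (symY g X Y) S) := by
  have key : ∀ (C : α → ℤ) (b : Bool), hull C S ⊆ hull (fun a => sgn b (C a)) S := by
    rintro C b p ⟨a, ha, a', ha', h1, h2⟩
    cases b
    · exact ⟨a, ha, a', ha', h1, h2⟩
    · exact ⟨a', ha', a, ha, neg_le_neg h2, neg_le_neg h1⟩
  obtain ⟨s, a, b⟩ := g
  cases s
  · exact ⟨Or.inl (key X a), Or.inr (key Y b)⟩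
  · exact ⟨Or.inr (key X b), Or.inl (key Y a)⟩

theorem symX_injective {X Y : α → ℤ} (hX : Function.Injective X) (hY : Function.Injective Y)
    (g : Bool × Bool × Bool) : Function.Injective (symX g X Y) := by
  intro p q hpq
  obtain ⟨s, a, b⟩ := g
  cases s <;> cases a <;> simp [symX, sgn] at hpq
  exacts [hX hpq, hX hpq, hY hpq, hY hpq]

theorem hasAlternation_of_wedge {X Y : α → ℤ} (hX : Function.Injective X)
    (hY : Function.Injective Y) (hXY : SimpleOn X Y Set.univ) {N n : ℕ} (hN : ¬ HasPins X Y (N + 1))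
    {g : Bool × Bool × Bool} {z : ℕ → α} (hn : 2 + (N + 1) * (N + 1) + 1 < n)
    (h : Wedge (symX g X Y) (symY g X Y) z n) : HasAlternation X Y (N + 1) := by
  have h01 : z 0 ≠ z 1 := fun he => by
    have := (h 0 1 (by omega) (by omega)).1
    rw [he] at this
    exact lt_irrefl _ this
  refine HasAlternation.of_sym g (h.hasAlternation_of_closure (symX_injective hX hY g)
    (S := closureSeq X Y {z 0, z 1}) (t := N + 1) (fun s => ?_) le_rfl
    (closureSeq_eq_univ_of_not_hasPins hX hY hXY hN (Set.nontrivial_pair h01)) hn)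
  have := hull_symX_or g X Y (closureSeq X Y {z 0, z 1} s)
  rcases Nat.mod_two_eq_zero_or_one s with hs | hs
  · simpa [closureSeq, coord, hs] using this.2
  · simpa [closureSeq, coord, hs] using this.1

/-! ### Counting -/

/-- `S` has points on both sides of the line `C = v + 1/2`. -/
def Straddles (C : α → ℤ) (v : ℤ) (S : Set α) : Prop := ∃ a ∈ S, ∃ b ∈ S, C a ≤ v ∧ v < C b

theorem exists_change {P : ℕ → Prop} {i j : ℕ} (hij : i ≤ j) (hi : P i) (hj : ¬ P j) :
    ∃ k, i ≤ k ∧ k < j ∧ P k ∧ ¬ P (k + 1) := by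
  by_contra hcon
  push Not at hcon
  have : ∀ k, i ≤ k → k ≤ j → P k := fun k hk => by
    induction k, hk using Nat.le_induction with
    | base => exact fun _ => hi
    | succ k hk ih => exact fun hkj => hcon k hk (by omega) (ih (by omega))
  exact hj (this j hij le_rfl)

/-- A straddling convex set contains a straddling pair of points that are consecutive with
respect to the other coordinate. -/
theorem exists_straddling_pair {C D : α → ℤ} {w : ℕ → α} {n : ℕ} (hC : Function.Injective C)
    (hC0 : ∀ a, 0 ≤ C a ∧ C a < n) (hw : ∀ k < n, C (w k) = k) {S : Set α} {v : ℤ}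
    (h : Straddles D v (hull C S)) :
    ∃ e, e + 1 < n ∧ Straddles D v {w e, w (e + 1)} ∧ Straddles C e S := by
  obtain ⟨a, ha, b, hb, hav, hbv⟩ := h
  have hwC : ∀ p, w (C p).toNat = p := fun p => hC (by
    have := hC0 p
    rw [hw _ (by omega)]; omega)
  have fin : ∀ a ∈ hull C S, ∀ b ∈ hull C S, ∀ k : ℕ, C a ≤ k → k < C b → k + 1 < n ∧
      Straddles C k S := by
    rintro a ⟨a', ha', -, -, h1, -⟩ b ⟨-, -, b', hb', -, h2⟩ k hak hkb
    have := hC0 b'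
    exact ⟨by omega, a', ha', b', hb', h1.trans hak, hkb.trans_le h2⟩
  have ha0 := hC0 a
  have hb0 := hC0 b
  rcases le_total (C a) (C b) with hab | hab
  · obtain ⟨k, h1, h2, h3, h4⟩ := exists_change (P := fun k => D (w k) ≤ v)
      (Int.toNat_le_toNat hab) (by simpa [hwC] using hav) (by simpa [hwC] using hbv)
    obtain ⟨h5, h6⟩ := fin a ha b hb k (by omega) (by omega)
    exact ⟨k, h5, ⟨w k, by simp, w (k + 1), by simp, h3, not_le.1 h4⟩, h6⟩
  · obtain ⟨k, h1, h2, h3, h4⟩ := exists_change (P := fun k => v < D (w k))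
      (Int.toNat_le_toNat hab) (by simpa [hwC] using hbv) (by simpa [hwC] using hav)
    obtain ⟨h5, h6⟩ := fin b hb a ha k (by omega) (by omega)
    exact ⟨k, h5, ⟨w (k + 1), by simp, w k, by simp, not_lt.1 h4, h3⟩, h6⟩

open Classical in
/-- If every line is straddled by few pairs of consecutive points then few pairs of consecutive
points have closures that straddle a given line. -/
theorem card_straddles_closureSeq_le {X Y : α → ℤ} {w : ℕ → ℕ → α} {n M : ℕ}
    (hC : ∀ m, Function.Injective (coord X Y m)) (hC0 : ∀ m a, 0 ≤ coord X Y m a ∧ coord X Y m a < n)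
    (hw : ∀ m, ∀ k < n, coord X Y m (w m k) = k) (hw2 : ∀ m, w (m + 2) = w m)
    (hM : ∀ m v, ((Finset.range (n - 1)).filter fun e =>
      Straddles (coord X Y m) v {w (m + 1) e, w (m + 1) (e + 1)}).card ≤ M) (t : ℕ) (v : ℤ) :
    ((Finset.range (n - 1)).filter fun e =>
      Straddles (coord X Y t) v (closureSeq X Y {w 1 e, w 1 (e + 1)} t)).card ≤ M ^ (t + 1) := by
  induction t generalizing v with
  | zero => rw [zero_add, pow_one]; exact hM 0 v
  | succ t ih =>
    -- A pair whose stage `t + 1` crosses the line `v` does so at some neighbours `k`, `k + 1` in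
    -- the other coordinate, and its stage `t` already crosses the line between them. There are at
    -- most `M` such `k`, each reached by at most `M ^ (t + 1)` pairs.
    have hsub : ((Finset.range (n - 1)).filter fun e =>
        Straddles (coord X Y (t + 1)) v (closureSeq X Y {w 1 e, w 1 (e + 1)} (t + 1))) ⊆
        ((Finset.range (n - 1)).filter fun e =>
          Straddles (coord X Y (t + 1)) v {w (t + 2) e, w (t + 2) (e + 1)}).biUnion fun v' =>
        (Finset.range (n - 1)).filter fun e =>
          Straddles (coord X Y t) v' (closureSeq X Y {w 1 e, w 1 (e + 1)} t) := by
      intro e he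
      obtain ⟨he1, he2⟩ := Finset.mem_filter.1 he
      obtain ⟨k, hk, h1, h2⟩ := exists_straddling_pair (hC t) (hC0 t) (hw t) he2
      refine Finset.mem_biUnion.2 ⟨k, Finset.mem_filter.2 ⟨Finset.mem_range.2 (by omega), ?_⟩,
        Finset.mem_filter.2 ⟨he1, h2⟩⟩
      rwa [hw2]
    refine (Finset.card_le_card hsub).trans ?_
    refine (Finset.card_biUnion_le_card_mul _ _ (M ^ (t + 1)) fun v' _ => ?_).trans ?_
    · exact ih (v' : ℤ)
    rw [pow_succ' M (t + 1)]
    exact Nat.mul_le_mul_right _ (hM (t + 1) v)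

open Classical in
/-- A large simple set without long pin sequences has a line straddled by many pairs of consecutive
points. -/
theorem exists_many_straddles {X Y : α → ℤ} {w : ℕ → ℕ → α} {n N M : ℕ}
    (hX : Function.Injective X) (hY : Function.Injective Y)
    (hX0 : ∀ a, 0 ≤ X a ∧ X a < n) (hY0 : ∀ a, 0 ≤ Y a ∧ Y a < n)
    (hw : ∀ m, ∀ k < n, coord X Y m (w m k) = k) (hw2 : ∀ m, w (m + 2) = w m)
    (hXY : SimpleOn X Y Set.univ) (hN : ¬ HasPins X Y (N + 1)) (hn : M ^ (N + 2) + 1 < n) :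
    ∃ m v, M < ((Finset.range (n - 1)).filter fun e =>
      Straddles (coord X Y m) v {w (m + 1) e, w (m + 1) (e + 1)}).card := by
  by_contra! hcon
  have hC : ∀ n, Function.Injective (coord X Y n) := fun n => by
    unfold coord; split_ifs <;> assumption
  have hC0 : ∀ m a, 0 ≤ coord X Y m a ∧ coord X Y m a < n := fun m a => by
    unfold coord; split_ifs
    exacts [hY0 a, hX0 a]
  have hle := card_straddles_closureSeq_le hC hC0 hw hw2 hcon (N + 1) 0
  -- After `N + 1` steps every closure is the whole set, so all `n - 1` pairs cross the lowest line.
  have hall : ((Finset.range (n - 1)).filter fun e => Straddles (coord X Y (N + 1)) 0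
      (closureSeq X Y {w 1 e, w 1 (e + 1)} (N + 1))) = Finset.range (n - 1) := by
    refine Finset.filter_true_of_mem fun e he => ?_
    have hen := Finset.mem_range.1 he
    have hne : w 1 e ≠ w 1 (e + 1) := fun h => by
      have h1 := hw 1 e (by omega)
      have h2 := hw 1 (e + 1) (by omega)
      rw [h, h2] at h1
      omega
    rw [closureSeq_eq_univ_of_not_hasPins hX hY hXY hN (Set.nontrivial_pair hne)]
    have h0 := hw (N + 1) 0 (by omega)
    have h1 := hw (N + 1) 1 (by omega)
    exact ⟨_, Set.mem_univ _, _, Set.mem_univ _, by rw [h0]; simp, by rw [h1]; simp⟩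
  rw [hall, Finset.card_range] at hle
  change n - 1 ≤ M ^ (N + 2) at hle
  omega

/-- At least half of the relevant pairs cross the line in the same direction, whence the factor 2.
-/
theorem exists_alternates_of_straddles (N : ℕ) : ∃ K : ℕ, ∀ (α : Type) (X Y : α → ℤ) (w : ℕ → α)
    (s : Finset ℕ) (v : ℤ), K ≤ s.card → Function.Injective Y → (∀ e ∈ s, X (w e) = e ∧ X (w (e + 1)) = e + 1) →
    (∀ e ∈ s, Straddles Y v {w e, w (e + 1)}) →
    ∃ b z c d, Alternates X (fun a => sgn b (Y a)) z c d N := by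
  classical
  obtain ⟨K, hK⟩ := exists_alternates N
  refine ⟨2 * K, fun α X Y w s v hs hY hw hv => ?_⟩
  have hv' : ∀ e ∈ s, (¬ v < Y (w e) → v < Y (w (e + 1))) ∧ (v < Y (w e) → Y (w (e + 1)) ≤ v) := by
    intro e he
    obtain ⟨a, ha, b, hb, h1, h2⟩ := hv e he
    simp only [Set.mem_insert_iff, Set.mem_singleton_iff] at ha hb
    rcases ha with rfl | rfl <;> rcases hb with rfl | rfl <;> constructor <;> intros <;> omega
  have hcard := Finset.card_filter_add_card_filter_not (s := s) (fun e => v < Y (w e))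
  have key : ∀ (Y' : α → ℤ) (s' : Finset ℕ) (v' : ℤ), s' ⊆ s → K ≤ s'.card → Function.Injective Y' →
      (∀ e ∈ s', v' < Y' (w e) ∧ Y' (w (e + 1)) ≤ v') → ∃ z c d, Alternates X Y' z c d N := by
    intro Y' s' v' hs' hK' hY' hsv
    refine hK α X Y' w (fun e => w (e + 1)) s' hK' hY' (fun e he => ?_) (fun e he e' he' hee => ?_)
      fun e he e' he' => (hsv e he).2.trans_lt (hsv e' he').1
    · have := hw e (hs' he); omega
    · have h1 := hw e (hs' he)
      have h2 := hw e' (hs' he')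
      -- Pairs crossing in the same direction are disjoint: a shared point would be both above and
      -- below the line.
      have h3 : e + 1 ≠ e' := by
        rintro rfl
        have h4 := (hsv e he).2
        have h5 := (hsv _ he').1
        omega
      omega
  rcases (by omega : K ≤ (s.filter fun e => v < Y (w e)).card ∨
      K ≤ (s.filter fun e => ¬ v < Y (w e)).card) with h | h
  · obtain ⟨z, c, d, hz⟩ := key Y _ v (Finset.filter_subset _ _) h hY fun e he => by
      obtain ⟨he1, he2⟩ := Finset.mem_filter.1 he
      exact ⟨he2, (hv' e he1).2 he2⟩
    exact ⟨false, z, c, d, hz⟩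
  -- Negation turns `Y ≤ v` into `-v - 1 < -Y`, so the threshold shifts by one.
  · obtain ⟨z, c, d, hz⟩ := key (fun a => - Y a) _ (-v - 1) (Finset.filter_subset _ _) h
      (neg_injective.comp hY) fun e he => by
        obtain ⟨he1, he2⟩ := Finset.mem_filter.1 he
        have := (hv' e he1).1 he2
        constructor <;> omega
    exact ⟨true, z, c, d, hz⟩

open Classical in
theorem exists_word_of_large_simple (N : ℕ) : ∃ n₀ : ℕ, ∀ (α : Type) (X Y : α → ℤ) (w : ℕ → ℕ → α)
    (n : ℕ), n₀ ≤ n → Function.Injective X → Function.Injective Y → (∀ a, 0 ≤ X a ∧ X a < n) →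
    (∀ a, 0 ≤ Y a ∧ Y a < n) → (∀ m, ∀ k < n, coord X Y m (w m k) = k) →
    (∀ m, w (m + 2) = w m) → SimpleOn X Y Set.univ →
    ∃ u f, Valid u (N + 1) ∧ Realizes X Y u f (N + 1) := by
  -- `L` is odd, as reversal requires, and exceeds the wedge length `2 + (N + 1) * (N + 1) + 1`
  -- needed to force a jump within `N + 1` steps.
  set L := 2 * ((N + 1) * (N + 1)) + 5 with hL
  obtain ⟨K, hK⟩ := exists_alternates_of_straddles L
  refine ⟨K ^ (N + 2) + 2, fun α X Y w n hn hX hY hX0 hY0 hw hw2 hXY => ?_⟩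
  by_cases hN : HasPins X Y (N + 1)
  · obtain ⟨u, f, -, h⟩ := hN
    exact ⟨u, f, h⟩
  refine HasAlternation.exists_word ?_
  obtain ⟨m, v, hmv⟩ := exists_many_straddles (M := K) hX hY hX0 hY0 hw hw2 hXY hN (by omega)
  have hC : Function.Injective (coord X Y m) := by
    unfold coord; split_ifs <;> assumption
  obtain ⟨b, z, c, d, hz⟩ := hK α (coord X Y (m + 1)) (coord X Y m) (w (m + 1)) _ v hmv.le hC
    (fun e he => by
      have := Finset.mem_range.1 (Finset.mem_filter.1 he).1
      exact ⟨hw _ _ (by omega), by rw [hw _ _ (by omega)]; simp⟩)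
    (fun e he => (Finset.mem_filter.1 he).2)
  obtain ⟨g, hg⟩ : ∃ g, symX g X Y = coord X Y (m + 1) ∧
      symY g X Y = fun a => sgn b (coord X Y m a) := by
    rcases Nat.mod_two_eq_zero_or_one m with hm | hm
    · have hm' : (m + 1) % 2 = 1 := by omega
      refine ⟨(false, false, b), ?_, ?_⟩ <;> funext a <;> simp [symX, symY, coord, hm, hm', sgn]
    · have hm' : (m + 1) % 2 = 0 := by omega
      refine ⟨(true, false, b), ?_, ?_⟩ <;> funext a <;> simp [symX, symY, coord, hm, hm', sgn]
  rw [← hg.1, ← hg.2] at hz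
  rcases hz.hasAlternation_or_wedge (by omega) with h | ⟨g', z', hz'⟩
  · exact HasAlternation.of_sym g (h.mono (by nlinarith))
  · obtain ⟨g'', hg''⟩ := exists_sym_sym (α := α) g g'
    rw [← (hg'' X Y).1, ← (hg'' X Y).2] at hz'
    exact hasAlternation_of_wedge hX hY hXY hN (by omega) hz'

/-! ### Simple point sets from words -/

theorem SimpleOn.of_lt {X Y : ℕ → ℤ} {N : ℕ}
    (h : ∀ S : Set ℕ, (∀ p ∈ S, p < N) → ∀ i ∈ S, ∀ j ∈ S, i < j →
      (∀ a ∈ S, ∀ b ∈ S, ∀ p < N, X a < X p → X p < X b → p ∈ S) →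
      (∀ a ∈ S, ∀ b ∈ S, ∀ p < N, Y a < Y p → Y p < Y b → p ∈ S) → ∀ p < N, p ∈ S) :
    SimpleOn X Y (Set.Iio N) := by
  intro S hS hS2 hcl
  obtain ⟨i, hi, j, hj, hij⟩ := hS2.exists_lt
  exact hS.antisymm (h S hS i hi j hj hij
    (fun a ha b hb p hp h1 h2 => hcl p hp ⟨a, ha, b, hb, Or.inl ⟨h1, h2⟩⟩)
    fun a ha b hb p hp h1 h2 => hcl p hp ⟨a, ha, b, hb, Or.inr ⟨h1, h2⟩⟩)

theorem cuts_sym (g : Bool × Bool × Bool) (X Y : α → ℤ) (S : Set α) (p : α) :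
    Cuts (symX g X Y) (symY g X Y) S p ↔ Cuts X Y S p := by
  obtain ⟨s, a, b⟩ := g
  constructor
  · rintro ⟨q, hq, r, hr, h⟩
    rcases h with h | h <;> cases s <;> cases a <;> cases b <;>
      simp only [symX, symY, sgn, if_true, if_false, Bool.false_eq_true, neg_lt_neg_iff] at h <;>
      first
      | exact ⟨q, hq, r, hr, Or.inl h⟩
      | exact ⟨q, hq, r, hr, Or.inr h⟩
      | exact ⟨r, hr, q, hq, Or.inl h.symm⟩
      | exact ⟨r, hr, q, hq, Or.inr h.symm⟩
  · rintro ⟨q, hq, r, hr, h⟩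
    rcases h with h | h <;> cases s <;> cases a <;> cases b <;>
      simp only [Cuts, symX, symY, sgn, if_true, if_false, Bool.false_eq_true, neg_lt_neg_iff] <;>
      first
      | exact ⟨q, hq, r, hr, Or.inl h⟩
      | exact ⟨q, hq, r, hr, Or.inr h⟩
      | exact ⟨r, hr, q, hq, Or.inl h.symm⟩
      | exact ⟨r, hr, q, hq, Or.inr h.symm⟩

theorem SimpleOn.sym {X Y : α → ℤ} {Q : Set α} (g : Bool × Bool × Bool) (h : SimpleOn X Y Q) :
    SimpleOn (symX g X Y) (symY g X Y) Q := fun S hS hS2 hcl =>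
  h S hS hS2 fun p hp hc => hcl p hp ((cuts_sym g X Y S p).2 hc)

theorem exists_sym_inv (g : Bool × Bool × Bool) : ∃ g' : Bool × Bool × Bool, ∀ X Y : α → ℤ,
    symX g (symX g' X Y) (symY g' X Y) = X ∧ symY g (symX g' X Y) (symY g' X Y) = Y := by
  obtain ⟨s, a, b⟩ := g
  refine ⟨(s, if s then b else a, if s then a else b), fun X Y => ?_⟩
  constructor <;> funext p <;> cases s <;> cases a <;> cases b <;> simp [symX, symY, sgn]

/-- The word `u` is realized by points some large subset of which is simple. -/
def HasSimple (u : ℕ → Letter) (N k : ℕ) : Prop :=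
  ∃ (X Y : ℕ → ℤ) (Q : Finset ℕ), (∀ p ∈ Q, p < N) ∧ k ≤ Q.card ∧ SimpleOn X Y Q ∧
    Realizes X Y u id N

theorem HasSimple.mono {u : ℕ → Letter} {N k k' : ℕ} (hk : k ≤ k') (h : HasSimple u N k') :
    HasSimple u N k := by
  obtain ⟨X, Y, Q, h1, h2, h3⟩ := h
  exact ⟨X, Y, Q, h1, hk.trans h2, h3⟩

theorem Realizes.congr {X Y : α → ℤ} {u u' : ℕ → Letter} {f : ℕ → α} {N : ℕ}
    (h : Realizes X Y u f N) (hu : ∀ i < N, u i = u' i) : Realizes X Y u' f N := by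
  intro i j hij hj
  rw [← hu i (hij.trans hj), ← hu j hj]
  exact h i j hij hj

theorem hasSimple_of_base {u : ℕ → Letter} {N : ℕ} {g : Bool × Bool × Bool} {t : ℕ → Fin 8}
    (hu : ∀ i < N, u i = (g, t i)) (ht : ∀ i, t i ≠ 7) {X Y : ℕ → ℤ} (hr : BaseReal X Y t id N)
    (hs : SimpleOn X Y (Set.Iio N)) : HasSimple u N N := by
  obtain ⟨g', hg'⟩ := exists_sym_inv (α := ℕ) g
  refine ⟨symX g' X Y, symY g' X Y, Finset.range N, by simp, by simp, ?_, ?_⟩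
  · simpa using hs.sym g'
  · refine Realizes.congr ?_ fun i hi => (hu i hi).symm
    rw [realizes_sym g _ _ t ht, (hg' X Y).1, (hg' X Y).2]
    exact hr

/-- Neighbours in an interval are an upper and a lower point. Vertically between them lie point `0`,
the lowest upper one, and, as `N` is even, point `N - 1`, the highest lower one. These are the
horizontal extremes, so everything follows. -/
theorem hasSimple_parKind {u : ℕ → Letter} {N : ℕ} {g : Bool × Bool × Bool} (hN : N % 2 = 0)
    (hu : ∀ i < N, u i = (g, parKind i)) : HasSimple u N N := by
  refine hasSimple_of_base hu (baseValid_parKind 0).1 (X := fun i => i)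
    (Y := fun i => if i % 2 = 0 then N + i else i) (fun i j hij hj => ?_) (SimpleOn.of_lt ?_)
  · rcases Nat.mod_two_eq_zero_or_one i with hi | hi <;>
      rcases Nat.mod_two_eq_zero_or_one j with hj' | hj' <;>
      simp [parKind, baseX, baseY, hi, hj', hij] <;> omega
  · intro S hS i hi j hj hij hX hY
    have hjN := hS j hj
    have hi1 : i + 1 ∈ S := by
      rcases Nat.eq_or_lt_of_le (show i + 1 ≤ j from hij) with h | h
      · rwa [h]
      · exact hX i hi j hj (i + 1) (by omega) (by simp) (by simp; omega)
    have key : 0 ∈ S ∧ N - 1 ∈ S := by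
      obtain ⟨a, ha, b, hb, ha2, hb2⟩ : ∃ a ∈ S, ∃ b ∈ S, a % 2 = 0 ∧ b % 2 = 1 := by
        rcases Nat.mod_two_eq_zero_or_one i with h | h
        · exact ⟨i, hi, i + 1, hi1, h, by omega⟩
        · exact ⟨i + 1, hi1, i, hi, by omega, h⟩
      have haN := hS a ha
      have hbN := hS b hb
      constructor
      · rcases Nat.eq_zero_or_pos a with rfl | h
        · exact ha
        · exact hY b hb a ha 0 (by omega) (by simp [hb2, hbN]) (by simp [ha2, h])
      · rcases Nat.eq_or_lt_of_le (show b ≤ N - 1 by omega) with h | h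
        · rwa [← h]
        · have e : (N - 1) % 2 = 1 := by omega
          refine hY b hb a ha (N - 1) (by omega) ?_ ?_
          · simp only [hb2, e, one_ne_zero, if_false]; omega
          · simp only [ha2, e, one_ne_zero, if_false, if_true]; omega
    intro p hp
    rcases Nat.eq_zero_or_pos p with rfl | h0
    · exact key.1
    rcases Nat.eq_or_lt_of_le (show p ≤ N - 1 by omega) with rfl | h1
    · exact key.2
    exact hX 0 key.1 (N - 1) key.2 p hp (Nat.cast_lt.2 h0) (Nat.cast_lt.2 h1)

/-- Consecutive wedge points enclose the mouth point `0` vertically. As `0` is rightmost, an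
interval containing it and a wedge point contains all later points, and the last two enclose all
others vertically. -/
theorem hasSimple_mouthKind {u : ℕ → Letter} {N : ℕ} {g : Bool × Bool × Bool} (hN : 5 ≤ N)
    (hu : ∀ i < N, u i = (g, mouthKind i)) : HasSimple u N N := by
  refine hasSimple_of_base hu (baseValid_mouthKind 0).1
    (X := fun i => if i = 0 then (N : ℤ) else i)
    (Y := fun i => if i % 2 = 1 then (i : ℤ) else -i) (fun i j hij hj => ?_) (SimpleOn.of_lt ?_)
  · have hj0 : j ≠ 0 := by omega
    rcases Nat.eq_zero_or_pos i with rfl | h0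
    · rcases Nat.mod_two_eq_zero_or_one j with hj' | hj' <;>
        simp [mouthKind, baseX, baseY, hj', hj0] <;> omega
    · rcases Nat.mod_two_eq_zero_or_one i with hi | hi <;>
        rcases Nat.mod_two_eq_zero_or_one j with hj' | hj' <;>
        simp [mouthKind, baseX, baseY, hi, hj', hij, hj0, h0.ne'] <;> omega
  · intro S hS i hi j hj hij hX hY
    have hjN := hS j hj
    have hj0 : j ≠ 0 := by omega
    have h0 : 0 ∈ S := by
      rcases Nat.eq_zero_or_pos i with rfl | hi0
      · exact hi
      have hi1 : i + 1 ∈ S := by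
        rcases Nat.eq_or_lt_of_le (show i + 1 ≤ j from hij) with h | h
        · rwa [h]
        · exact hX i hi j hj (i + 1) (by omega) (by simp [hi0.ne']) (by simp [hj0]; omega)
      rcases Nat.mod_two_eq_zero_or_one i with h | h
      · have e : (i + 1) % 2 = 1 := by omega
        exact hY i hi (i + 1) hi1 0 (by omega) (by simp [h, hi0]) (by simp [e])
      · have e : (i + 1) % 2 = 0 := by omega
        exact hY (i + 1) hi1 i hi 0 (by omega) (by simp [e]; omega) (by simp [h]; omega)
    have hge : ∀ k ∈ S, k ≠ 0 → ∀ p, k ≤ p → p < N → p ∈ S := by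
      intro k hk hk0 p hkp hp
      rcases Nat.eq_or_lt_of_le hkp with rfl | h
      · exact hk
      · exact hX k hk 0 h0 p hp (by simp [hk0]; omega) (by simp; omega)
    have hN2 : N - 2 ∈ S := by
      rcases Nat.eq_or_lt_of_le (show j ≤ N - 1 by omega) with rfl | h
      -- If only `0` and the last point are known to be in `S`, the previous wedge point on the same
      -- side lies between them.
      · have hN3 : N - 3 ∈ S := by
          rcases Nat.mod_two_eq_zero_or_one (N - 1) with h | h
          · have e : (N - 3) % 2 = 0 := by omega
            exact hY (N - 1) hj 0 h0 (N - 3) (by omega) (by simp [h, e]; omega) (by simp [e]; omega)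
          · have e : (N - 3) % 2 = 1 := by omega
            exact hY 0 h0 (N - 1) hj (N - 3) (by omega) (by simp [e]; omega) (by simp [h, e]; omega)
        exact hge _ hN3 (by omega) _ (by omega) (by omega)
      · exact hge _ hj hj0 _ (by omega) (by omega)
    have hN1 : N - 1 ∈ S := hge _ hN2 (by omega) _ (by omega) (by omega)
    intro p hp
    rcases Nat.eq_zero_or_pos p with rfl | hp0
    · exact h0
    rcases Nat.lt_or_ge p (N - 2) with hlt | hge'
    · rcases Nat.mod_two_eq_zero_or_one N with h | h
      · have e1 : (N - 1) % 2 = 1 := by omega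
        have e2 : (N - 2) % 2 = 0 := by omega
        refine hY (N - 2) hN2 (N - 1) hN1 p hp ?_ ?_ <;> simp only [e1, e2, zero_ne_one, if_true, if_false] <;> split_ifs <;> omega
      · have e1 : (N - 1) % 2 = 0 := by omega
        have e2 : (N - 2) % 2 = 1 := by omega
        refine hY (N - 1) hN1 (N - 2) hN2 p hp ?_ ?_ <;> simp only [e1, e2, zero_ne_one, if_true, if_false] <;> split_ifs <;> omega
    · exact hge _ hN2 (by omega) _ hge' hp

/-- Consecutive wedge points enclose the tip `0` vertically, and horizontal convexity then brings in
the high point `1`. Between their heights lies the last point `N - 1`, which is an upper one since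
`N` is odd. -/
theorem hasSimple_tipKind {u : ℕ → Letter} {N : ℕ} {g : Bool × Bool × Bool} (hN : 5 ≤ N)
    (hN2 : N % 2 = 1) (hu : ∀ i < N, u i = (g, tipKind i)) : HasSimple u N N := by
  refine hasSimple_of_base hu (baseValid_tipKind 0).1 (X := fun i => i)
    (Y := fun i => if i = 1 then (N : ℤ) else if i % 2 = 0 then (i : ℤ) else -i)
    (fun i j hij hj => ?_) (SimpleOn.of_lt ?_)
  · have hj0 : j ≠ 0 := by omega
    by_cases h0 : i = 0
    · subst h0
      by_cases hj1 : j = 1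
      · subst hj1
        simp [tipKind, baseX, baseY]; omega
      · rcases Nat.mod_two_eq_zero_or_one j with hj' | hj' <;>
          simp [tipKind, baseX, baseY, hj', hj0, hj1] <;> omega
    have hj1 : j ≠ 1 := by omega
    by_cases h1 : i = 1
    · subst h1
      rcases Nat.mod_two_eq_zero_or_one j with hj' | hj' <;>
        simp [tipKind, baseX, baseY, hj', hj0, hj1] <;> omega
    rcases Nat.mod_two_eq_zero_or_one i with hi | hi <;>
      rcases Nat.mod_two_eq_zero_or_one j with hj' | hj' <;>
      simp [tipKind, baseX, baseY, hi, hj', hij, hj0, hj1, h0, h1] <;> omega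
  · intro S hS i hi j hj hij hX hY
    have hX' : ∀ a ∈ S, ∀ b ∈ S, ∀ p, a ≤ p → p ≤ b → p ∈ S := by
      intro a ha b hb p hap hpb
      have := hS b hb
      rcases Nat.eq_or_lt_of_le hap with rfl | h1
      · exact ha
      rcases Nat.eq_or_lt_of_le hpb with rfl | h2
      · exact hb
      exact hX a ha b hb p (by omega) (by simpa using h1) (by simpa using h2)
    have hjN := hS j hj
    have hi1 : i + 1 ∈ S := hX' i hi j hj _ (by omega) hij
    have tip : ∀ k ∈ S, k + 1 ∈ S → 2 ≤ k → 0 ∈ S := by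
      intro k hk hk1 hk2
      have := hS _ hk1
      rcases Nat.mod_two_eq_zero_or_one k with h | h
      · have e : (k + 1) % 2 = 1 := by omega
        refine hY (k + 1) hk1 k hk 0 (by omega) ?_ ?_ <;>
          simp only [h, e, one_ne_zero, zero_ne_one, if_true, if_false] <;> split_ifs <;> omega
      · have e : (k + 1) % 2 = 0 := by omega
        refine hY k hk (k + 1) hk1 0 (by omega) ?_ ?_ <;>
          simp only [h, e, one_ne_zero, zero_ne_one, if_true, if_false] <;> split_ifs <;> omega
    have h0 : 0 ∈ S := by
      rcases Nat.lt_or_ge 1 i with h | h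
      · exact tip i hi hi1 h
      rcases Nat.eq_zero_or_pos i with rfl | h'
      · exact hi
      obtain rfl : i = 1 := by omega
      have h4 : 4 ∈ S := by
        refine hY 2 hi1 1 hi 4 (by omega) ?_ ?_ <;> simp; omega
      exact tip 2 hi1 (hX' 2 hi1 4 h4 3 (by omega) (by omega)) le_rfl
    have h1 : 1 ∈ S := hX' 0 h0 (i + 1) hi1 1 (by omega) (by omega)
    have hlast : N - 1 ∈ S := by
      have e : (N - 1) % 2 = 0 := by omega
      refine hY 0 h0 1 h1 (N - 1) (by omega) ?_ ?_ <;>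
        simp only [e, zero_ne_one, if_true, if_false] <;> split_ifs <;> omega
    intro p hp
    exact hX' 0 h0 (N - 1) hlast p (by omega) (by omega)

/-! ### Simple subsets of pin sequences -/

/-- A subset of `Set.Iio N` that no other point below `N` cuts. -/
def CutClosed (X Y : ℕ → ℤ) (N : ℕ) (S : Set ℕ) : Prop :=
  (∀ p ∈ S, p < N) ∧ ∀ n e, ∀ a ∈ S, ∀ b ∈ S, ∀ p < N,
    Cmp e (coord X Y n a) (coord X Y n p) → Cmp e (coord X Y n p) (coord X Y n b) → p ∈ S

theorem CutClosed.of_not_cuts {X Y : ℕ → ℤ} {N : ℕ} {S : Set ℕ} (hS : ∀ p ∈ S, p < N)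
    (h : ∀ p < N, Cuts X Y S p → p ∈ S) : CutClosed X Y N S := by
  refine ⟨hS, fun n e a ha b hb p hp h1 h2 => h p hp ?_⟩
  unfold coord at h1 h2
  split_ifs at h1 h2 <;> cases e
  · exact ⟨b, hb, a, ha, Or.inr ⟨h2, h1⟩⟩
  · exact ⟨a, ha, b, hb, Or.inr ⟨h1, h2⟩⟩
  · exact ⟨b, hb, a, ha, Or.inl ⟨h2, h1⟩⟩
  · exact ⟨a, ha, b, hb, Or.inl ⟨h1, h2⟩⟩

section PinSeq

variable {X Y : ℕ → ℤ} {c : ℕ → Bool} {M : ℕ} {S : Set ℕ}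

theorem PinSeq.own (h : PinSeq X Y c id M) {i j : ℕ} (hij : i < j) (hj : j ≤ M) :
    Cmp (c j) (coord X Y j i) (coord X Y j j) := (h i j hij hj).1

/-- With `PinSeq.separates`: in the direction of pin `j`, the next pin lies beyond all points before
`j` but short of `j`. -/
theorem PinSeq.next (h : PinSeq X Y c id M) {i j : ℕ} (hij : i < j) (hj : j + 1 ≤ M) :
    Cmp (c j) (coord X Y j i) (coord X Y j (j + 1)) := by
  have h2 := (h i (j + 1) (by omega) hj).2
  have : j ≠ i := by omega
  simpa [coord_add_two, this] using h2

theorem PinSeq.separates (h : PinSeq X Y c id M) {j : ℕ} (hj : j + 1 ≤ M) :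
    Cmp (c j) (coord X Y j (j + 1)) (coord X Y j j) := by
  have h2 := (h j (j + 1) (by omega) hj).2
  revert h2
  simp only [coord_add_two]
  cases hc : c j <;> simp [hc]

theorem PinSeq.succ_mem (h : PinSeq X Y c id M) (hS : CutClosed X Y (M + 1) S) {i j : ℕ}
    (hi : i ∈ S) (hj : j ∈ S) (hij : i < j) (hjM : j + 1 ≤ M) : j + 1 ∈ S :=
  hS.2 j (c j) i hi j hj (j + 1) (by omega) (h.next hij hjM) (h.separates hjM)

theorem PinSeq.mem_of_le (h : PinSeq X Y c id M) (hS : CutClosed X Y (M + 1) S) {i j : ℕ}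
    (hi : i ∈ S) (hj : j ∈ S) (hij : i < j) {k : ℕ} (hjk : j ≤ k) (hk : k ≤ M) : k ∈ S := by
  induction k, hjk using Nat.le_induction with
  | base => exact hj
  | succ k hjk ih => exact h.succ_mem hS hi (ih (by omega)) (by omega) hk

/-- Pins `k + 1` and `k + 3` use the same axis. On equal sides, pin `k + 1` lies between `k + 2` and
`k + 3`; on opposite sides, point `k` does. -/
theorem PinSeq.exists_mem_of_consecutive (h : PinSeq X Y c id M) (hS : CutClosed X Y (M + 1) S)
    {k : ℕ} (h2 : k + 2 ∈ S) (h3 : k + 3 ∈ S) : k ∈ S ∨ k + 1 ∈ S := by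
  have hM := hS.1 _ h3
  have e : coord X Y (k + 3) = coord X Y (k + 1) := coord_add_two X Y (k + 1)
  have s1 : Cmp (c (k + 1)) _ _ := h.separates (show k + 2 ≤ M by omega)
  by_cases hc : c (k + 3) = c (k + 1)
  · right
    have s2 := h.own (show k + 1 < k + 3 by omega) (by omega)
    rw [e, hc] at s2
    exact hS.2 (k + 1) (c (k + 1)) _ h2 _ h3 _ (by omega) s1 s2
  · left
    have s2 := h.own (show k < k + 3 by omega) (by omega)
    have s3 : Cmp (c (k + 1)) _ _ := h.next (show k < k + 1 by omega) (show k + 2 ≤ M by omega)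
    rw [e, show c (k + 3) = !c (k + 1) by simpa [← Bool.not_eq] using hc] at s2
    refine hS.2 (k + 1) (c (k + 1)) _ h3 _ h2 _ (by omega) ?_ s3
    cases hc1 : c (k + 1) <;> simpa [hc1] using s2

/-- Pin `l + 2` is forced into `S`. If it points like pin `l`, then `l` lies between `i` and `l +
2`; otherwise every point before `l` lies between `l + 2` and `l + 1`. -/
theorem PinSeq.exists_mem_of_gap (h : PinSeq X Y c id M) (hS : CutClosed X Y (M + 1) S)
    {i l : ℕ} (hi : i ∈ S) (hl : l + 1 ∈ S) (hil : i < l) (hl2 : 2 ≤ l) (hlM : l + 2 ≤ M) :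
    ∃ k < l + 1, k ≠ i ∧ k ∈ S := by
  have hl' : l + 2 ∈ S := h.succ_mem hS hi hl (by omega) hlM
  have e : coord X Y (l + 2) = coord X Y l := coord_add_two X Y l
  by_cases hc : c (l + 2) = c l
  · have s1 := h.own hil (by omega)
    have s2 := h.own (show l < l + 2 by omega) hlM
    rw [e, hc] at s2
    exact ⟨l, by omega, hil.ne', hS.2 l (c l) _ hi _ hl' _ (by omega) s1 s2⟩
  · obtain ⟨k, hk, hki⟩ : ∃ k < l, k ≠ i := by
      by_cases h0 : i = 0
      · exact ⟨1, by omega, by omega⟩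
      · exact ⟨0, by omega, by omega⟩
    have s1 := h.next hk (show l + 1 ≤ M by omega)
    have s2 := h.own (show k < l + 2 by omega) hlM
    rw [e, show c (l + 2) = !c l by simpa [← Bool.not_eq] using hc] at s2
    refine ⟨k, by omega, hki, hS.2 l (c l) _ hl' _ hl _ (by omega) ?_ s1⟩
    cases hc1 : c l <;> simpa [hc1] using s2

/-- On the axis of pin `k + 1`, all points up to `k + 2` lie on the same side of the last pin.
Depending on that side, either `k + 1` or `k` lies between `k + 2` and `M`. -/
theorem PinSeq.exists_mem_of_last (h : PinSeq X Y c id M) (hS : CutClosed X Y (M + 1) S)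
    {k : ℕ} (hk : k + 2 ∈ S) (hM : M ∈ S) (hkM : k + 3 < M) : k ∈ S ∨ k + 1 ∈ S := by
  have s1 : Cmp (c (k + 1)) _ _ := h.next (show k < k + 1 by omega) (show k + 2 ≤ M by omega)
  have s2 : Cmp (c (k + 1)) _ _ := h.separates (show k + 2 ≤ M by omega)
  obtain ⟨e, he⟩ : ∃ e, ∀ x ≤ k + 2, Cmp e (coord X Y (k + 1) x) (coord X Y (k + 1) M) := by
    rcases Nat.mod_two_eq_zero_or_one (M - (k + 1)) with hp | hp
    · have e1 : coord X Y (k + 1) = coord X Y M := by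
        unfold coord
        rw [show (k + 1) % 2 = M % 2 by omega]
      rw [e1]
      exact ⟨c M, fun x hx => h.own (by omega) le_rfl⟩
    · have e1 : coord X Y (k + 1) = coord X Y (M - 1) := by
        unfold coord
        rw [show (k + 1) % 2 = (M - 1) % 2 by omega]
      rw [e1]
      refine ⟨c (M - 1), fun x hx => ?_⟩
      have := h.next (show x < M - 1 by omega) (by omega)
      rwa [show M - 1 + 1 = M by omega] at this
  by_cases hc : e = c (k + 1)
  · right
    subst hc
    exact hS.2 (k + 1) _ _ hk _ hM _ (by omega) s2 (he _ (by omega))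
  · left
    have s3 := he k (by omega)
    rw [show e = !c (k + 1) by simpa [← Bool.not_eq] using hc] at s3
    refine hS.2 (k + 1) (c (k + 1)) _ hM _ hk _ (by omega) ?_ s1
    cases hc1 : c (k + 1) <;> simpa [hc1] using s3

theorem PinSeq.mem_of_first_last (h : PinSeq X Y c id M) (hS : CutClosed X Y (M + 1) S)
    {i k : ℕ} (hi : i ∈ S) (hM : M ∈ S) (hik : i < k) (hkM : k < M) (hk : k % 2 = M % 2)
    (hc : c M = c k) : k ∈ S := by
  have e : coord X Y k = coord X Y M := by unfold coord; rw [hk]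
  have s1 := h.own hik hkM.le
  have s2 := h.own hkM le_rfl
  rw [e, ← hc] at s1
  exact hS.2 M (c M) _ hi _ hM _ (by omega) s1 s2

/-- The two least elements `i < j` of `S` are examined: if `2 < j`, some cutting point contradicts
minimality. The condition on `c M` handles a set formed by the last pin and one of the first two
points, which no further pin would cut. -/
theorem PinSeq.mem_of_nontrivial (h : PinSeq X Y c id M) (hS : CutClosed X Y (M + 1) S)
    (hM : 7 ≤ M) (hc : c M = c (M - 2) ∨ c M = c (M - 4)) (hS2 : S.Nontrivial) :
    (∀ k, 2 ≤ k → k ≤ M → k ∈ S) ∧ (0 ∈ S ∨ 1 ∈ S) := by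
  classical
  have hne : ∃ i, i ∈ S := hS2.nonempty
  set i := Nat.find hne with hi_def
  have hi : i ∈ S := Nat.find_spec hne
  have hmin : ∀ k < i, k ∉ S := fun k hk => Nat.find_min hne hk
  have hne' : ∃ j, j ∈ S ∧ j ≠ i := by
    obtain ⟨j, hj, hji⟩ := hS2.exists_ne i
    exact ⟨j, hj, hji⟩
  set j := Nat.find hne' with hj_def
  obtain ⟨hj, hji⟩ : j ∈ S ∧ j ≠ i := Nat.find_spec hne'
  have hmin' : ∀ k < j, k ≠ i → k ∉ S := fun k hk hki hkS => Nat.find_min hne' hk ⟨hkS, hki⟩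
  have hij : i < j := lt_of_le_of_ne (not_lt.1 fun hlt => hmin j hlt hj) hji.symm
  have hjM := hS.1 j hj
  clear_value i j
  suffices hj2 : j ≤ 2 by
    refine ⟨fun k hk hkM => h.mem_of_le hS hi hj hij (by omega) hkM, ?_⟩
    rcases Nat.eq_zero_or_pos i with rfl | h0
    · exact Or.inl hi
    · obtain rfl : i = 1 := by omega
      exact Or.inr hi
  by_contra hj3
  rcases Nat.eq_or_lt_of_le (show i + 1 ≤ j from hij) with he | hlt
  · obtain ⟨k, rfl⟩ : ∃ k, i = k + 2 := ⟨i - 2, by omega⟩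
    subst he
    rcases h.exists_mem_of_consecutive hS hi hj with h' | h'
    · exact hmin _ (by omega) h'
    · exact hmin _ (by omega) h'
  · rcases Nat.eq_or_lt_of_le (show j ≤ M by omega) with rfl | hjM'
    · rcases Nat.lt_or_ge 1 i with h1 | h1
      · obtain ⟨k, rfl⟩ : ∃ k, i = k + 2 := ⟨i - 2, by omega⟩
        by_cases hk : k + 3 < j
        · rcases h.exists_mem_of_last hS hi hj hk with h' | h'
          · exact hmin _ (by omega) h'
          · exact hmin _ (by omega) h'
        · omega
      · rcases hc with hc | hc
        · exact hmin' (j - 2) (by omega) (by omega)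
            (h.mem_of_first_last hS hi hj (by omega) (by omega) (by omega) hc)
        · exact hmin' (j - 4) (by omega) (by omega)
            (h.mem_of_first_last hS hi hj (by omega) (by omega) (by omega) hc)
    · obtain ⟨l, rfl⟩ : ∃ l, j = l + 1 := ⟨j - 1, by omega⟩
      obtain ⟨k, hk, hki, hkS⟩ := h.exists_mem_of_gap hS hi hj (by omega) (by omega) (by omega)
      exact hmin' k hk hki hkS

/-- If the whole sequence is not simple, a proper nontrivial closed set omits exactly one of the
points `0`, `1`. It is itself simple, since a closed subset of it is closed in the whole sequence.
-/
theorem PinSeq.exists_simpleOn (h : PinSeq X Y c id M) (hM : 7 ≤ M)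
    (hc : c M = c (M - 2) ∨ c M = c (M - 4)) :
    ∃ Q : Finset ℕ, (∀ p ∈ Q, p < M + 1) ∧ M ≤ Q.card ∧ SimpleOn X Y Q := by
  classical
  by_cases hall : SimpleOn X Y (Set.Iio (M + 1))
  · exact ⟨Finset.range (M + 1), by simp, by simp, by simpa using hall⟩
  unfold SimpleOn at hall
  push Not at hall
  obtain ⟨S, hSM, hS2, hScl, hSne⟩ := hall
  have hS : CutClosed X Y (M + 1) S := CutClosed.of_not_cuts hSM hScl
  obtain ⟨hge, h01⟩ := h.mem_of_nontrivial hS hM hc hS2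
  obtain ⟨i, hi, hi'⟩ : ∃ i, i ≤ 1 ∧ S = Set.Iio (M + 1) \ {i} := by
    have hnot : ¬ (0 ∈ S ∧ 1 ∈ S) := fun h01 => hSne (hSM.antisymm fun p hp => by
      have hp' : p < M + 1 := hp
      rcases Nat.lt_or_ge p 2 with hp2 | hp2
      · rcases Nat.eq_zero_or_pos p with rfl | hp0
        · exact h01.1
        · obtain rfl : p = 1 := by omega
          exact h01.2
      · exact hge p hp2 (by omega))
    rcases h01 with h0 | h1
    · refine ⟨1, le_rfl, Set.ext fun p => ⟨fun hp => ⟨hSM hp, ?_⟩, ?_⟩⟩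
      · rintro rfl
        exact hnot ⟨h0, hp⟩
      · rintro ⟨hp, hp1⟩
        have hp' : p < M + 1 := hp
        have hp1' : p ≠ 1 := hp1
        rcases Nat.eq_zero_or_pos p with rfl | hp0
        · exact h0
        · exact hge p (by omega) (by omega)
    · refine ⟨0, by omega, Set.ext fun p => ⟨fun hp => ⟨hSM hp, ?_⟩, ?_⟩⟩
      · rintro rfl
        exact hnot ⟨hp, h1⟩
      · rintro ⟨hp, hp1⟩
        have hp' : p < M + 1 := hp
        have hp1' : p ≠ 0 := hp1
        rcases Nat.eq_or_lt_of_le (show 1 ≤ p by omega) with rfl | hp0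
        · exact h1
        · exact hge p (by omega) (by omega)
  refine ⟨(Finset.range (M + 1)).erase i, fun p hp => ?_, ?_, ?_⟩
  · exact Finset.mem_range.1 (Finset.mem_of_mem_erase hp)
  · rw [Finset.card_erase_of_mem (Finset.mem_range.2 (by omega))]
    simp
  · rw [Finset.coe_erase, Finset.coe_range, ← hi']
    intro T hTS hT2 hTcl
    have hT : CutClosed X Y (M + 1) T := by
      refine CutClosed.of_not_cuts (fun p hp => hSM (hTS hp)) fun p hp hcut => hTcl p ?_ hcut
      obtain ⟨a, ha, b, hb, hab⟩ := hcut
      exact hScl p hp ⟨a, hTS ha, b, hTS hb, hab⟩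
    obtain ⟨hge', h01'⟩ := h.mem_of_nontrivial hT hM hc hT2
    refine hTS.antisymm fun p hp => ?_
    have hpM : p < M + 1 := hSM hp
    rcases Nat.lt_or_ge p 2 with hp2 | hp2
    · have hpi : p ≠ i := by
        rw [hi'] at hp
        exact hp.2
      have hiT : i ∉ T := fun hiT => by
        have := hTS hiT
        rw [hi'] at this
        exact this.2 rfl
      rcases h01' with h0 | h1
      · have : i ≠ 0 := fun he => hiT (he ▸ h0)
        obtain rfl : p = 0 := by omega
        exact h0
      · have : i ≠ 1 := fun he => hiT (he ▸ h1)
        obtain rfl : p = 1 := by omega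
        exact h1
    · exact hge' p hp2 (by omega)

end PinSeq

theorem exists_pinSeq_id (c : ℕ → Bool) : ∃ X Y : ℕ → ℤ, ∀ M, PinSeq X Y c id M := by
  -- Pin `n` has own coordinate `±(2n + 2)`; pin `n + 1` takes `±(2n + 1)` on that axis with the
  -- same sign, just inside it and outside everything earlier.
  refine ⟨fun n => if n % 2 = 0 then sgn (!c (n - 1)) (2 * n - 1) else sgn (!c n) (2 * n + 2),
    fun n => if n % 2 = 0 then sgn (!c n) (2 * n + 2) else sgn (!c (n - 1)) (2 * n - 1),
    fun M i j hij _ => ?_⟩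
  obtain ⟨j, rfl⟩ : ∃ k, j = k + 1 := ⟨j - 1, by omega⟩
  simp only [id, add_tsub_cancel_right]
  by_cases hji : j = i
  · subst hji
    rcases Nat.mod_two_eq_zero_or_one j with hj | hj
    · have hj' : (j + 1) % 2 = 1 := by omega
      have hj'' : (j + 1 + 1) % 2 = 0 := by omega
      simp only [coord, hj, hj', hj'', if_true, one_ne_zero, if_false, decide_true]
      cases c (j + 1) <;> cases c j <;> cases c (j - 1) <;> simp [sgn] <;> omega
    · have hj' : (j + 1) % 2 = 0 := by omega
      have hj'' : (j + 1 + 1) % 2 = 1 := by omega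
      simp only [coord, hj, hj', hj'', if_true, one_ne_zero, if_false, decide_true]
      cases c (j + 1) <;> cases c j <;> cases c (j - 1) <;> simp [sgn] <;> omega
  · have hji' : ¬ (j + 1 = i + 1) := by omega
    rcases Nat.mod_two_eq_zero_or_one j with hj | hj
    · have hj' : (j + 1) % 2 = 1 := by omega
      have hj'' : (j + 1 + 1) % 2 = 0 := by omega
      simp only [coord, hj', hj'', if_true, one_ne_zero, if_false, hji', decide_false, add_tsub_cancel_right]
      rcases Nat.mod_two_eq_zero_or_one i with hi | hi <;> simp only [hi, if_true, one_ne_zero, if_false] <;>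
        cases c (j + 1) <;> cases c j <;> cases c i <;> cases c (i - 1) <;> simp [sgn] <;> omega
    · have hj' : (j + 1) % 2 = 0 := by omega
      have hj'' : (j + 1 + 1) % 2 = 1 := by omega
      simp only [coord, hj', hj'', if_true, one_ne_zero, if_false, hji', decide_false, add_tsub_cancel_right]
      rcases Nat.mod_two_eq_zero_or_one i with hi | hi <;> simp only [hi, if_true, one_ne_zero, if_false] <;>
        cases c (j + 1) <;> cases c j <;> cases c i <;> cases c (i - 1) <;> simp [sgn] <;> omega

/-! ### Long valid words contain large simple point sets -/

/-- The only kind that can follow a given kind in an alternation. -/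
def nextKind (s : Fin 8) : Fin 8 :=
  if s = 0 then 1 else if s = 1 then 0 else if s = 2 then 3 else if s = 5 then 6 else 2

theorem baseNext.eq {s t : Fin 8} (h : baseNext s t) : t = nextKind s := by
  revert s t; decide

/-- Kinds of alternations have unique successors and the symmetry is constant, so the first letter
determines the word. -/
theorem Valid.eq_of_kind {u : ℕ → Letter} {N : ℕ} (hu : Valid u N) {t : ℕ → Fin 8}
    (ht : ∀ i, t i ≠ 7) (h0 : (u 0).2 = t 0) (hs : ∀ i, nextKind (t i) = t (i + 1)) :
    ∀ i < N, u i = ((u 0).1, t i) := by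
  intro i
  induction i with
  | zero => exact fun _ => Prod.ext rfl h0
  | succ i ih =>
    intro hi
    have h := hu.2 i hi
    rw [ih (by omega)] at h
    unfold letterNext at h
    split_ifs at h
    · exact absurd h.1 (ht i)
    · exact Prod.ext h.1.symm (h.2.eq.trans (hs i))

theorem Valid.mono {u : ℕ → Letter} {N N' : ℕ} (hN : N' ≤ N) (h : Valid u N) : Valid u N' :=
  ⟨h.1, fun i hi => h.2 i (by omega)⟩

theorem SimpleOn.swap {α : Type*} {X Y : α → ℤ} {Q : Set α} (h : SimpleOn X Y Q) : SimpleOn Y X Q :=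
  h.sym (true, false, false)

theorem Valid.pin_eq {u : ℕ → Letter} {N : ℕ} (hu : Valid u N) (h7 : (u 0).2 = 7) :
    ∀ i < N, (u i).2 = 7 ∧ (u i).1.1 = (decide (i % 2 = 1) ^^ (u 0).1.1) ∧
      (0 < i → (u i).1.2.1 = (u (i - 1)).1.2.2) := by
  have hk : ∀ i < N, (u i).2 = 7 := by
    intro i
    induction i with
    | zero => exact fun _ => h7
    | succ i ih =>
      intro hi
      have h := hu.2 i hi
      have hi7 := ih (by omega)
      unfold letterNext at h
      split_ifs at h with h'
      · exact h'
      · have h2 := h.2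
        rw [hi7] at h2
        revert h2
        generalize (u (i + 1)).2 = t
        revert t
        decide
  intro i
  induction i with
  | zero => exact fun _ => ⟨h7, by simp, fun h => absurd h (lt_irrefl 0)⟩
  | succ i ih =>
    intro hi
    have h := hu.2 i hi
    obtain ⟨-, h2, -⟩ := ih (by omega)
    have h7' := hk _ hi
    simp only [letterNext, h7', if_true] at h
    refine ⟨h7', ?_, fun _ => by simpa using h.2.2⟩
    rw [h.2.1, h2]
    rcases Nat.mod_two_eq_zero_or_one i with hp | hp
    · have hp' : (i + 1) % 2 = 1 := by omega
      simp [hp, hp']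
    · have hp' : (i + 1) % 2 = 0 := by omega
      simp [hp, hp']

theorem Valid.realizes_of_pinSeq {u : ℕ → Letter} {N : ℕ} (hu : Valid u N) (h7 : (u 0).2 = 7)
    {X Y : ℕ → ℤ} (h : PinSeq X Y (fun i => (u i).1.2.2) id (N - 1)) :
    Realizes (if (u 0).1.1 then Y else X) (if (u 0).1.1 then X else Y) u id N := by
  intro i j hij hj
  obtain ⟨h1, h2⟩ := h i j hij (by omega)
  obtain ⟨e1, e2, e3⟩ := hu.pin_eq h7 j hj
  have e3 := e3 (by omega)
  simp only at h2
  rw [← e3] at h2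
  rcases Nat.mod_two_eq_zero_or_one j with hp | hp
  · have hp' : (j + 1) % 2 = 1 := by omega
    simp only [coord, hp, hp', if_true, one_ne_zero, if_false] at h1 h2
    cases h0 : (u 0).1.1
    · simpa [letterX, letterY, e1, e2, hp, h0] using ⟨h2, h1⟩
    · simpa [letterX, letterY, e1, e2, hp, h0] using ⟨h1, h2⟩
  · have hp' : (j + 1) % 2 = 0 := by omega
    simp only [coord, hp, hp', if_true, one_ne_zero, if_false] at h1 h2
    cases h0 : (u 0).1.1
    · simpa [letterX, letterY, e1, e2, hp, h0] using ⟨h1, h2⟩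
    · simpa [letterX, letterY, e1, e2, hp, h0] using ⟨h2, h1⟩

theorem Valid.hasSimple_of_pin {u : ℕ → Letter} {N : ℕ} (hN : 13 ≤ N) (hu : Valid u N)
    (h7 : (u 0).2 = 7) : ∃ N' ≤ N, HasSimple u N' (N - 5) := by
  set c : ℕ → Bool := fun i => (u i).1.2.2 with hc
  -- If `c (N - 3)` differs from `c (N - 5)`, these are both truth values, and `c (N - 1)` equals
  -- one of them.
  obtain ⟨M, hM, hMN, hcM⟩ : ∃ M, N - 3 ≤ M ∧ M + 1 ≤ N ∧ (c M = c (M - 2) ∨ c M = c (M - 4)) := by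
    by_cases h : c (N - 3) = c (N - 5) ∨ c (N - 3) = c (N - 7)
    · exact ⟨N - 3, le_rfl, by omega, h⟩
    · refine ⟨N - 1, by omega, by omega, ?_⟩
      rw [show N - 1 - 2 = N - 3 by omega, show N - 1 - 4 = N - 5 by omega]
      push Not at h
      have := h.1
      cases h1 : c (N - 1) <;> cases h2 : c (N - 3) <;> cases h3 : c (N - 5) <;> simp_all
  obtain ⟨X, Y, hpin⟩ := exists_pinSeq_id c
  obtain ⟨Q, hQ, hQM, hs⟩ := (hpin M).exists_simpleOn (by omega) hcM
  have hr := (hu.mono hMN).realizes_of_pinSeq h7 (X := X) (Y := Y) (hpin M)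
  refine ⟨M + 1, hMN, _, _, Q, hQ, by omega, ?_, hr⟩
  cases (u 0).1.1
  · simpa using hs
  · simpa using hs.swap

theorem Valid.exists_hasSimple {u : ℕ → Letter} {N : ℕ} (hN : 13 ≤ N) (hu : Valid u N) :
    ∃ N' ≤ N, HasSimple u N' (N - 5) := by
  rcases hu.1 with h | h | h | h
  · have hk := hu.eq_of_kind (baseValid_parKind 0).1 h fun i => by
      rcases Nat.mod_two_eq_zero_or_one i with hp | hp
      · have hp' : (i + 1) % 2 = 1 := by omega
        simp [parKind, hp, hp', nextKind]
      · have hp' : (i + 1) % 2 = 0 := by omega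
        simp [parKind, hp, hp', nextKind]
    exact ⟨N / 2 * 2, by omega,
      (hasSimple_parKind (by omega) fun i hi => hk i (by omega)).mono (by omega)⟩
  · have hk := hu.eq_of_kind (baseValid_mouthKind 0).1 h fun i => by
      rcases Nat.eq_zero_or_pos i with rfl | h0
      · simp [mouthKind, nextKind]
      rcases Nat.mod_two_eq_zero_or_one i with hp | hp
      · have hp' : (i + 1) % 2 = 1 := by omega
        simp [mouthKind, hp, hp', nextKind, h0.ne']
      · have hp' : (i + 1) % 2 = 0 := by omega
        simp [mouthKind, hp, hp', nextKind, h0.ne']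
    exact ⟨N, le_rfl, (hasSimple_mouthKind (by omega) hk).mono (by omega)⟩
  · have hk := hu.eq_of_kind (baseValid_tipKind 0).1 h fun i => by
      by_cases h0 : i = 0
      · subst h0; simp [tipKind, nextKind]
      by_cases h1 : i = 1
      · subst h1; simp [tipKind, nextKind]
      rcases Nat.mod_two_eq_zero_or_one i with hp | hp
      · have hp' : (i + 1) % 2 = 1 := by omega
        simp [tipKind, hp, hp', nextKind, h0, h1]
      · have hp' : (i + 1) % 2 = 0 := by omega
        simp [tipKind, hp, hp', nextKind, h0, h1]
    exact ⟨(N - 1) / 2 * 2 + 1, by omega,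
      (hasSimple_tipKind (by omega) (by omega) fun i hi => hk i (by omega)).mono (by omega)⟩
  · exact hu.hasSimple_of_pin hN h

/-! ### Permutations and point sets -/

theorem exists_rank_equiv {α : Type*} (Q : Finset α) {X : α → ℤ} (hX : Set.InjOn X Q) :
    ∃ e : Q ≃ Fin Q.card, ∀ p q : Q, e p < e q ↔ X p < X q := by
  classical
  have hc : (Q.image X).card = Q.card := Finset.card_image_of_injOn hX
  let φ : Q → Fin Q.card := fun p =>
    ((Q.image X).orderIsoOfFin hc).symm ⟨X p, Finset.mem_image_of_mem X p.2⟩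
  have hφ : ∀ p q : Q, φ p < φ q ↔ X p < X q := fun p q => by
    simp [φ]
  have hinj : Function.Injective φ := fun p q h => by
    have h1 := (hφ p q).not.1 h.not_lt
    have h2 := (hφ q p).not.1 h.symm.not_lt
    exact Subtype.ext (hX p.2 q.2 (le_antisymm (not_lt.1 h2) (not_lt.1 h1)))
  exact ⟨Equiv.ofBijective φ ((Fintype.bijective_iff_injective_and_card φ).2 ⟨hinj, by simp⟩), hφ⟩

/-- A finite point set is the graph of a permutation, up to order isomorphism. -/
theorem exists_permutation {α : Type*} (Q : Finset α) {X Y : α → ℤ} (hX : Set.InjOn X Q)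
    (hY : Set.InjOn Y Q) : ∃ (π : Permutation) (e : Fin π.1 ≃ Q), π.1 = Q.card ∧
      (∀ i j, i < j ↔ X (e i) < X (e j)) ∧ ∀ i j, π.2 i < π.2 j ↔ Y (e i) < Y (e j) := by
  obtain ⟨a, ha⟩ := exists_rank_equiv Q hX
  obtain ⟨b, hb⟩ := exists_rank_equiv Q hY
  refine ⟨⟨Q.card, a.symm.trans b⟩, a.symm, rfl, fun i j => ?_, fun i j => ?_⟩
  · rw [← ha]; simp
  · rw [← hb]; simp

theorem isSimple_of_simpleOn {α : Type*} {Q : Finset α} {X Y : α → ℤ} (h : SimpleOn X Y Q)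
    {π : Permutation} (e : Fin π.1 ≃ Q) (hX : ∀ i j, i < j ↔ X (e i) < X (e j))
    (hY : ∀ i j, π.2 i < π.2 j ↔ Y (e i) < Y (e j)) : π.IsSimple := by
  rintro I ⟨hI1, hI2⟩
  rcases Nat.lt_or_ge 1 I.ncard with hc | hc
  · right; right
    obtain ⟨i, hi, j, hj, hij⟩ := (Set.one_lt_ncard (Set.toFinite I)).1 hc
    have hS := h ((fun i => (e i : α)) '' I) (by rintro _ ⟨i, -, rfl⟩; exact (e i).2)
      ⟨_, ⟨i, hi, rfl⟩, _, ⟨j, hj, rfl⟩, fun he => hij (e.injective (Subtype.ext he))⟩ ?_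
    · have : I = Set.univ := by
        ext k
        refine ⟨fun _ => trivial, fun _ => ?_⟩
        have hk : (e k : α) ∈ (fun i => (e i : α)) '' I := by rw [hS]; exact (e k).2
        obtain ⟨k', hk', he⟩ := hk
        rwa [← e.injective (Subtype.ext he)]
      rw [this, Set.ncard_univ]
      simp
    · rintro p hp ⟨_, ⟨a, ha, rfl⟩, _, ⟨b, hb, rfl⟩, hab⟩
      obtain ⟨k, hk⟩ := e.surjective ⟨p, hp⟩
      have hkp : (e k : α) = p := by rw [hk]
      rw [← hkp] at hab ⊢
      refine ⟨k, ?_, rfl⟩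
      rcases hab with ⟨h1, h2⟩ | ⟨h1, h2⟩
      · exact hI1.out ha hb ⟨((hX a k).2 h1).le, ((hX k b).2 h2).le⟩
      · obtain ⟨k', hk', he⟩ := hI2.out ⟨a, ha, rfl⟩ ⟨b, hb, rfl⟩
          ⟨((hY a k).2 h1).le, ((hY k b).2 h2).le⟩
        rwa [← π.2.injective he]
  · omega

theorem simpleOn_of_isSimple {π : Permutation} (h : π.IsSimple) :
    SimpleOn (fun i : Fin π.1 => ((i : ℕ) : ℤ)) (fun i => ((π.2 i : ℕ) : ℤ)) Set.univ := by
  rintro S - hS2 hcl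
  have hint : π.IsInterval S := by
    constructor
    · refine ⟨fun a ha b hb p hp => ?_⟩
      rcases eq_or_lt_of_le hp.1 with rfl | h1
      · exact ha
      rcases eq_or_lt_of_le hp.2 with rfl | h2
      · exact hb
      exact hcl p trivial ⟨a, ha, b, hb, Or.inl ⟨by simpa using h1, by simpa using h2⟩⟩
    · refine ⟨?_⟩
      rintro _ ⟨a, ha, rfl⟩ _ ⟨b, hb, rfl⟩ p hp
      obtain ⟨q, rfl⟩ := π.2.surjective p
      rcases eq_or_lt_of_le hp.1 with h1 | h1
      · exact ⟨a, ha, h1⟩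
      rcases eq_or_lt_of_le hp.2 with h2 | h2
      · exact ⟨b, hb, h2.symm⟩
      exact ⟨q, hcl q trivial ⟨a, ha, b, hb, Or.inr ⟨by simpa using h1, by simpa using h2⟩⟩, rfl⟩
  have h1 := (Set.one_lt_ncard (Set.toFinite S)).2 (by
    obtain ⟨a, ha, b, hb, hab⟩ := hS2
    exact ⟨a, ha, b, hb, hab⟩)
  have h2 := h S hint
  refine Set.eq_of_subset_of_ncard_le (Set.subset_univ S) ?_
  rw [Set.ncard_univ]
  simp
  omega

/-- Every long simple permutation realizes a long valid word. -/
theorem exists_word_of_isSimple (N : ℕ) : ∃ n₀ : ℕ, ∀ π : Permutation, π.IsSimple → n₀ ≤ π.1 →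
    ∃ (u : ℕ → Letter) (f : ℕ → Fin π.1), Valid u (N + 1) ∧
      Realizes (fun i : Fin π.1 => ((i : ℕ) : ℤ)) (fun i => ((π.2 i : ℕ) : ℤ)) u f (N + 1) := by
  obtain ⟨n₀, hn₀⟩ := exists_word_of_large_simple N
  refine ⟨n₀ + 1, fun π hπ hn => ?_⟩
  have : NeZero π.1 := ⟨by omega⟩
  refine hn₀ _ _ _ (fun m k => if m % 2 = 0 then π.2.symm (Fin.ofNat π.1 k) else Fin.ofNat π.1 k)
    π.1 (by omega) ?_ ?_ ?_ ?_ ?_ (fun m => by simp) (simpleOn_of_isSimple hπ)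
  · intro i j h
    simpa [Fin.ext_iff] using h
  · intro i j h
    simpa [← Fin.ext_iff] using h
  · intro i; simp
  · intro i; simp
  · intro m k hk
    rcases Nat.mod_two_eq_zero_or_one m with hm | hm <;> simp [coord, hm, Nat.mod_eq_of_lt hk]

/-! ### Patterns in words -/

/-- The pattern whose points have heights `r` occurs among the first `N` points of the word `u`. -/
def WordContains (u : ℕ → Letter) (N : ℕ) {k : ℕ} (r : Fin k → ℕ) : Prop :=
  ∃ f : Fin k → ℕ, Function.Injective f ∧ (∀ i, f i < N) ∧ ∀ i j, f i < f j →
    letterX (u (f i)) (u (f j)) (decide (f j = f i + 1)) = decide (i < j) ∧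
    letterY (u (f i)) (u (f j)) (decide (f j = f i + 1)) = decide (r i < r j)

theorem WordContains.mono {u : ℕ → Letter} {N N' k : ℕ} {r : Fin k → ℕ} (hN : N ≤ N')
    (h : WordContains u N r) : WordContains u N' r := by
  obtain ⟨f, h1, h2, h3⟩ := h
  exact ⟨f, h1, fun i => (h2 i).trans_le hN, h3⟩

theorem wordContains_orderIso {u : ℕ → Letter} {N k k' : ℕ} {r : Fin k → ℕ} {r' : Fin k' → ℕ}
    (e : Fin k ≃o Fin k') (he : ∀ i j, r i < r j ↔ r' (e i) < r' (e j)) (h : WordContains u N r') :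
    WordContains u N r := by
  obtain ⟨f, h1, h2, h3⟩ := h
  refine ⟨f ∘ e, h1.comp e.injective, fun i => h2 _, fun i j hij => ?_⟩
  have := h3 (e i) (e j) hij
  simpa [he] using this

theorem contains_of_wordContains {π β : Permutation} {u : ℕ → Letter}
    {f : ℕ → Fin π.1} {N : ℕ}
    (hr : Realizes (fun i : Fin π.1 => ((i : ℕ) : ℤ)) (fun i => ((π.2 i : ℕ) : ℤ)) u f N)
    (h : WordContains u N fun i => (β.2 i : ℕ)) : π.Contains β := by
  obtain ⟨g, hg, hgN, hgr⟩ := h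
  have key : ∀ i j, i ≠ j → (f (g i) < f (g j) ↔ i < j) ∧
      (π.2 (f (g i)) < π.2 (f (g j)) ↔ β.2 i < β.2 j) := by
    intro i j hij
    rcases lt_or_gt_of_ne (hg.ne hij) with hlt | hlt
    · obtain ⟨h1, h2⟩ := hr _ _ hlt (hgN j)
      obtain ⟨h3, h4⟩ := hgr i j hlt
      rw [h3] at h1
      rw [h4] at h2
      exact ⟨by simpa using h1.lt_iff, by simpa using h2.lt_iff⟩
    · obtain ⟨h1, h2⟩ := hr _ _ hlt (hgN i)
      obtain ⟨h3, h4⟩ := hgr j i hlt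
      rw [h3] at h1
      rw [h4] at h2
      have h5 := h1.gt_iff
      have h6 := h2.gt_iff
      have hne : ¬ β.2 i = β.2 j := fun h => hij (β.2.injective h)
      simp only [decide_eq_false_iff_not, not_lt, Nat.cast_lt, Fin.val_fin_lt] at h5 h6
      exact ⟨h5.trans ⟨fun h => lt_of_le_of_ne h hij, le_of_lt⟩,
        h6.trans ⟨fun h => lt_of_le_of_ne h hne, le_of_lt⟩⟩
  refine ⟨OrderEmbedding.ofStrictMono (fun i => f (g i)) fun i j hij => ((key i j hij.ne).1).2 hij,
    fun i j => ?_⟩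
  by_cases hij : i = j
  · subst hij; simp
  · exact (key i j hij).2.symm

theorem wordContains_of_contains {π β : Permutation} {u : ℕ → Letter} {X Y : ℕ → ℤ}
    {Q : Finset ℕ} {N : ℕ} (hr : Realizes X Y u id N) (hQ : ∀ p ∈ Q, p < N) (e : Fin π.1 ≃ Q)
    (hX : ∀ i j, i < j ↔ X (e i) < X (e j)) (hY : ∀ i j, π.2 i < π.2 j ↔ Y (e i) < Y (e j))
    (h : π.Contains β) : WordContains u N fun i => (β.2 i : ℕ) := by
  obtain ⟨g, hg⟩ := h
  refine ⟨fun i => e (g i), fun i j hij => g.injective (e.injective (Subtype.ext hij)),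
    fun i => hQ _ (e (g i)).2, fun i j hij => ?_⟩
  obtain ⟨h1, h2⟩ := hr _ _ hij (hQ _ (e (g j)).2)
  have h3 := h1.lt_iff
  have h4 := h2.lt_iff
  simp only [id] at h3 h4
  rw [← hX, g.lt_iff_lt] at h3
  rw [← hY, ← hg] at h4
  exact ⟨Bool.eq_iff_iff.2 (by simpa using h3.symm), Bool.eq_iff_iff.2 (by simpa using h4.symm)⟩

theorem Realizes.injOn {X Y : ℕ → ℤ} {u : ℕ → Letter} {N : ℕ} (h : Realizes X Y u id N)
    {Q : Finset ℕ} (hQ : ∀ p ∈ Q, p < N) : Set.InjOn X Q ∧ Set.InjOn Y Q := by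
  have hne : ∀ (b : Bool) (x y : ℤ), Cmp b x y → x ≠ y := fun b x y h => by
    cases b <;> simp at h <;> omega
  constructor <;> intro p hp q hq hpq <;> rcases lt_trichotomy p q with hlt | he | hlt
  · exact absurd hpq (hne _ _ _ (h p q hlt (hQ q hq)).1)
  · exact he
  · exact absurd hpq.symm (hne _ _ _ (h q p hlt (hQ p hp)).1)
  · exact absurd hpq (hne _ _ _ (h p q hlt (hQ q hq)).2)
  · exact he
  · exact absurd hpq.symm (hne _ _ _ (h q p hlt (hQ p hp)).2)

/-- A class contains infinitely many simple permutations if and only if it contains arbitrarily long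
valid words. -/
theorem infinite_simple_iff (B : Set Permutation) :
    {π : Permutation | π ∈ Permutation.Av B ∧ π.IsSimple}.Infinite ↔
      ∀ N, ∃ u, Valid u (N + 1) ∧ ∀ β ∈ B, ¬ WordContains u (N + 1) fun i => (β.2 i : ℕ) := by
  have hfin : ∀ n, {π : Permutation | π.1 ≤ n}.Finite := fun n => by
    refine Set.Finite.subset (Set.finite_range fun x : (Σ m : Fin (n + 1), Equiv.Perm (Fin m)) =>
      (⟨x.1, x.2⟩ : Permutation)) ?_
    rintro ⟨m, σ⟩ hm
    exact ⟨⟨⟨m, Nat.lt_succ_of_le hm⟩, σ⟩, rfl⟩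
  constructor
  · intro h N
    obtain ⟨n₀, hn₀⟩ := exists_word_of_isSimple N
    obtain ⟨π, hπ, hπn⟩ := h.exists_notMem_finite (hfin n₀)
    obtain ⟨u, f, hu, hr⟩ := hn₀ π hπ.2 (not_le.1 hπn).le
    exact ⟨u, hu, fun β hβ hc => hπ.1 β hβ (contains_of_wordContains hr hc)⟩
  · intro h hf
    obtain ⟨n, hn⟩ : ∃ n, ∀ π ∈ {π : Permutation | π ∈ Permutation.Av B ∧ π.IsSimple}, π.1 ≤ n := by
      obtain ⟨n, hn⟩ := (hf.image Sigma.fst).bddAbove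
      exact ⟨n, fun π hπ => hn ⟨π, hπ, rfl⟩⟩
    -- A word with `n + 21` letters yields a simple permutation with at least `n + 16` points, more
    -- than the supposed bound `n`.
    obtain ⟨u, hu, hB⟩ := h (n + 20)
    obtain ⟨N', hN', X, Y, Q, hQ, hQn, hs, hr⟩ := hu.exists_hasSimple (by omega)
    obtain ⟨hXi, hYi⟩ := hr.injOn hQ
    obtain ⟨π, e, hπQ, hX, hY⟩ := exists_permutation Q hXi hYi
    have := hn π ⟨fun β hβ hc => hB β hβ
      ((wordContains_of_contains hr hQ e hX hY hc).mono hN'),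
      isSimple_of_simpleOn hs e hX hY⟩
    omega

/-! ### Pumping -/

/-- Which points of a pattern have been placed, with which letters, and which one is the last point
of the word. -/
abbrev Profile (k : ℕ) : Type := (Fin k → Option Letter) × Option (Fin k)

/-- The profiles of the partial occurrences of a pattern among the first `n` points of a word. -/
def profiles (u : ℕ → Letter) (n : ℕ) {k : ℕ} (r : Fin k → ℕ) : Set (Profile k) :=
  {s | ∃ f : Fin k → ℕ, (∀ i a, s.1 i = some a → f i < n ∧ u (f i) = a) ∧
    (∀ i j, s.1 i ≠ none → s.1 j ≠ none → f i = f j → i = j) ∧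
    (∀ i j, s.1 i ≠ none → s.1 j ≠ none → f i < f j →
      letterX (u (f i)) (u (f j)) (decide (f j = f i + 1)) = decide (i < j) ∧
      letterY (u (f i)) (u (f j)) (decide (f j = f i + 1)) = decide (r i < r j)) ∧
    ∀ i, s.2 = some i ↔ s.1 i ≠ none ∧ f i + 1 = n}

/-- The effect of one more letter on profiles. -/
def profileStep {k : ℕ} (r : Fin k → ℕ) (a : Letter) (s s' : Profile k) : Prop :=
  s' = (s.1, none) ∨ ∃ i, s.1 i = none ∧ s' = (Function.update s.1 i (some a), some i) ∧
    ∀ j b, s.1 j = some b → letterX b a (decide (s.2 = some j)) = decide (j < i) ∧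
      letterY b a (decide (s.2 = some j)) = decide (r j < r i)

/-- The effect of one more letter on sets of profiles. -/
def profilesStep {k : ℕ} (r : Fin k → ℕ) (a : Letter) (T : Set (Profile k)) : Set (Profile k) :=
  {s' | ∃ s ∈ T, profileStep r a s s'}

theorem profiles_zero (u u' : ℕ → Letter) {k : ℕ} (r : Fin k → ℕ) :
    profiles u 0 r = profiles u' 0 r := by
  have key : ∀ u u' : ℕ → Letter, profiles u 0 r ⊆ profiles u' 0 r := by
    rintro u u' s ⟨f, h1, h2, h3, h4⟩
    have hnone : ∀ i, s.1 i = none := fun i => by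
      by_contra h
      obtain ⟨a, ha⟩ := Option.ne_none_iff_exists'.1 h
      exact absurd (h1 i a ha).1 (by omega)
    refine ⟨f, fun i a ha => ?_, h2, fun i j hi => absurd (hnone i) hi, h4⟩
    rw [hnone i] at ha
    exact absurd ha (by simp)
  exact (key u u').antisymm (key u' u)

/-- This makes `profiles` the state of a finite automaton: the new point is either unused or plays
one pattern point `i`. Its position relative to the placed points depends only on stored letters and
on which of them, if any, is the immediately preceding point. -/
theorem profiles_succ (u : ℕ → Letter) (n : ℕ) {k : ℕ} (r : Fin k → ℕ) :
    profiles u (n + 1) r = profilesStep r (u n) (profiles u n r) := by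
  classical
  have lt_of : ∀ (s : Profile k) (f : Fin k → ℕ) (m : ℕ),
      (∀ i a, s.1 i = some a → f i < m ∧ u (f i) = a) → ∀ i, s.1 i ≠ none → f i < m := by
    intro s f m h i hi
    obtain ⟨a, ha⟩ := Option.ne_none_iff_exists'.1 hi
    exact (h i a ha).1
  ext ⟨c, l⟩
  constructor
  · rintro ⟨f, h1, h2, h3, h4⟩
    have hlt := lt_of _ _ _ h1
    simp only at h1 h2 h3 h4 hlt
    by_cases hl : ∃ i, c i ≠ none ∧ f i = n
    · obtain ⟨i, hi, hin⟩ := hl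
      have hci : c i = some (u n) := by
        obtain ⟨a, ha⟩ := Option.ne_none_iff_exists'.1 hi
        rw [ha, ← (h1 i a ha).2, hin]
      have hlt' : ∀ j, j ≠ i → c j ≠ none → f j < n := fun j hj hcj =>
        lt_of_le_of_ne (Nat.lt_succ_iff.1 (hlt j hcj)) fun he => hj (h2 j i hcj hi (he.trans hin.symm))
      have hex : ∃ l' : Option (Fin k), ∀ j, l' = some j ↔
          Function.update c i none j ≠ none ∧ f j + 1 = n := by
        by_cases hj : ∃ j, Function.update c i none j ≠ none ∧ f j + 1 = n
        · obtain ⟨j, hj1, hj2⟩ := hj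
          refine ⟨some j, fun j' => ⟨fun he => ?_, fun ⟨h5, h6⟩ => ?_⟩⟩
          · obtain rfl := Option.some.inj he
            exact ⟨hj1, hj2⟩
          · have e1 : j ≠ i := fun he => hj1 (by simp [he])
            have e2 : j' ≠ i := fun he => h5 (by simp [he])
            rw [Function.update_of_ne e1] at hj1
            rw [Function.update_of_ne e2] at h5
            rw [h2 j j' hj1 h5 (by omega)]
        · refine ⟨none, fun j => ⟨fun he => absurd he (by simp), fun he => absurd ⟨j, he⟩ hj⟩⟩
      obtain ⟨l', hl'⟩ := hex
      have hup : ∀ j, Function.update c i none j ≠ none → j ≠ i ∧ c j ≠ none := fun j hj => by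
        have e : j ≠ i := fun he => hj (by simp [he])
        exact ⟨e, by rwa [Function.update_of_ne e] at hj⟩
      -- The previous profile forgets the pattern point at position `n`; `l'` records the one at
      -- position `n - 1`, if any.
      refine ⟨(Function.update c i none, l'), ⟨f, ?_, ?_, ?_, hl'⟩, Or.inr ⟨i, by simp, ?_, ?_⟩⟩
      · intro j a hj
        obtain ⟨e1, e2⟩ := hup j (by simp only at hj; rw [hj]; simp)
        simp only [Function.update_of_ne e1] at hj
        exact ⟨hlt' j e1 e2, (h1 j a hj).2⟩
      · exact fun j j' hj hj' => h2 j j' (hup j hj).2 (hup j' hj').2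
      · exact fun j j' hj hj' => h3 j j' (hup j hj).2 (hup j' hj').2
      · refine Prod.ext ?_ ?_
        · simp only [Function.update_idem]
          rw [← hci, Function.update_eq_self]
        · exact (h4 i).2 ⟨hi, by omega⟩
      · intro j b hj
        obtain ⟨e1, e2⟩ := hup j (by simp only at hj; rw [hj]; simp)
        simp only [Function.update_of_ne e1] at hj
        have h5 := h3 j i e2 hi (by rw [hin]; exact hlt' j e1 e2)
        rw [hin, (h1 j b hj).2] at h5
        have h6 : (l' = some j) ↔ n = f j + 1 := by
          rw [hl' j, Function.update_of_ne e1]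
          exact ⟨fun h => h.2.symm, fun h => ⟨e2, h.symm⟩⟩
        simpa only [h6] using h5
    · have hlt' : ∀ j, c j ≠ none → f j < n := fun j hcj =>
        lt_of_le_of_ne (Nat.lt_succ_iff.1 (hlt j hcj)) fun he => hl ⟨j, hcj, he⟩
      have hex : ∃ l' : Option (Fin k), ∀ j, l' = some j ↔ c j ≠ none ∧ f j + 1 = n := by
        by_cases hj : ∃ j, c j ≠ none ∧ f j + 1 = n
        · obtain ⟨j, hj1, hj2⟩ := hj
          refine ⟨some j, fun j' => ⟨fun he => ?_, fun ⟨h5, h6⟩ => ?_⟩⟩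
          · obtain rfl := Option.some.inj he
            exact ⟨hj1, hj2⟩
          · rw [h2 j j' hj1 h5 (by omega)]
        · refine ⟨none, fun j => ⟨fun he => absurd he (by simp), fun he => absurd ⟨j, he⟩ hj⟩⟩
      obtain ⟨l', hl'⟩ := hex
      refine ⟨(c, l'), ⟨f, fun j a hj => ⟨hlt' j (by simp only at hj; rw [hj]; simp), (h1 j a hj).2⟩,
        h2, h3, hl'⟩, Or.inl (Prod.ext rfl ?_)⟩
      rcases l with _ | i
      · rfl
      · obtain ⟨h5, h6⟩ := (h4 i).1 rfl
        exact absurd ⟨i, h5, by omega⟩ hl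
  · rintro ⟨⟨c', l'⟩, ⟨f, h1, h2, h3, h4⟩, hs | ⟨i, hi, hs, hc⟩⟩
    · simp only [Prod.mk.injEq] at hs
      obtain ⟨rfl, rfl⟩ := hs
      have hlt := lt_of _ _ _ h1
      refine ⟨f, fun j a hj => ⟨(h1 j a hj).1.trans (Nat.lt_succ_self n), (h1 j a hj).2⟩, h2, h3,
        fun j => ⟨fun h => absurd h (by simp), fun ⟨h5, h6⟩ => ?_⟩⟩
      have := hlt j h5
      omega
    · simp only [Prod.mk.injEq] at hs
      obtain ⟨rfl, rfl⟩ := hs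
      have hlt := lt_of _ _ _ h1
      simp only at h1 h2 h3 h4 hi hc hlt ⊢
      have hup : ∀ j, j ≠ i → Function.update c' i (some (u n)) j ≠ none → c' j ≠ none :=
        fun j hj h => by rwa [Function.update_of_ne hj] at h
      refine ⟨Function.update f i n, ?_, ?_, ?_, ?_⟩
      · intro j a hj
        by_cases hji : j = i
        · subst hji
          simp only [Function.update_self, Option.some.injEq] at hj ⊢
          exact ⟨Nat.lt_succ_self n, hj⟩
        · simp only [Function.update_of_ne hji] at hj ⊢
          exact ⟨(h1 j a hj).1.trans (Nat.lt_succ_self n), (h1 j a hj).2⟩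
      · intro j j' hj hj' he
        by_cases hji : j = i <;> by_cases hji' : j' = i
        · rw [hji, hji']
        · subst hji
          simp only [Function.update_self, Function.update_of_ne hji'] at he
          have := hlt j' (hup j' hji' hj')
          omega
        · subst hji'
          simp only [Function.update_self, Function.update_of_ne hji] at he
          have := hlt j (hup j hji hj)
          omega
        · simp only [Function.update_of_ne hji, Function.update_of_ne hji'] at he
          exact h2 j j' (hup j hji hj) (hup j' hji' hj') he
      · intro j j' hj hj' hjj
        by_cases hji : j = i <;> by_cases hji' : j' = i
        · rw [hji, hji'] at hjj
          exact absurd hjj (lt_irrefl _)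
        · subst hji
          simp only [Function.update_self, Function.update_of_ne hji'] at hjj
          have := hlt j' (hup j' hji' hj')
          omega
        · subst hji'
          simp only [Function.update_self, Function.update_of_ne hji] at hjj ⊢
          have hj0 := hup j hji hj
          obtain ⟨b, hb⟩ := Option.ne_none_iff_exists'.1 hj0
          have h5 := hc j b hb
          have h6 : (l' = some j) ↔ n = f j + 1 :=
            (h4 j).trans ⟨fun h => h.2.symm, fun h => ⟨hj0, h.symm⟩⟩
          rw [(h1 j b hb).2]
          simpa only [h6] using h5
        · simp only [Function.update_of_ne hji, Function.update_of_ne hji'] at hjj ⊢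
          exact h3 j j' (hup j hji hj) (hup j' hji' hj') hjj
      · intro j
        by_cases hji : j = i
        · subst hji; simp
        · simp only [Option.some.injEq, Function.update_of_ne hji, ne_eq]
          refine ⟨fun h => absurd h.symm hji, fun ⟨h5, h6⟩ => ?_⟩
          have := hlt j h5
          omega

theorem wordContains_iff_profiles {u : ℕ → Letter} {n k : ℕ} {r : Fin k → ℕ} :
    WordContains u n r ↔ ∃ s ∈ profiles u n r, ∀ i, s.1 i ≠ none := by
  classical
  constructor
  · rintro ⟨f, h1, h2, h3⟩
    have hex : ∃ l : Option (Fin k), ∀ j, l = some j ↔ f j + 1 = n := by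
      by_cases hj : ∃ j, f j + 1 = n
      · obtain ⟨j, hj⟩ := hj
        refine ⟨some j, fun j' => ⟨fun he => ?_, fun h => ?_⟩⟩
        · obtain rfl := Option.some.inj he
          exact hj
        · rw [h1 (show f j = f j' by omega)]
      · exact ⟨none, fun j => ⟨fun he => absurd he (by simp), fun he => absurd ⟨j, he⟩ hj⟩⟩
    obtain ⟨l, hl⟩ := hex
    refine ⟨(fun i => some (u (f i)), l), ⟨f, fun i a ha => ⟨h2 i, Option.some.inj ha⟩,
      fun i j _ _ h => h1 h, fun i j _ _ h => h3 i j h, fun i => by simp [hl]⟩, fun i => by simp⟩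
  · rintro ⟨s, ⟨f, h1, h2, h3, h4⟩, hs⟩
    refine ⟨f, fun i j h => h2 i j (hs i) (hs j) h, fun i => ?_, fun i j h => h3 i j (hs i) (hs j) h⟩
    obtain ⟨a, ha⟩ := Option.ne_none_iff_exists'.1 (hs i)
    exact (h1 i a ha).1

/-- A walk in a finite graph that is long enough yields an infinite one. -/
theorem exists_infinite_walk {Q : Type*} [Fintype Q] {R : Q → Q → Prop} (s : ℕ → Q)
    (h : ∀ i < Fintype.card Q, R (s i) (s (i + 1))) :
    ∃ s' : ℕ → Q, s' 0 = s 0 ∧ ∀ i, R (s' i) (s' (i + 1)) := by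
  obtain ⟨i, j, hij, hs⟩ : ∃ i j : Fin (Fintype.card Q + 1), i < j ∧ s i = s j := by
    obtain ⟨i, j, hne, hs⟩ := Fintype.exists_ne_map_eq_of_card_lt
      (fun i : Fin (Fintype.card Q + 1) => s i) (by simp)
    rcases lt_or_gt_of_ne hne with h | h
    · exact ⟨i, j, h, hs⟩
    · exact ⟨j, i, h, hs.symm⟩
  have hj := j.2
  have hij' : (i : ℕ) < j := hij
  -- The indices run up to the repetition and then cycle through `i, …, j - 1`.
  let g : ℕ → ℕ := fun n => Nat.rec 0 (fun _ m => if m + 1 = (j : ℕ) then (i : ℕ) else m + 1) n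
  have hg : ∀ n, g (n + 1) = if g n + 1 = (j : ℕ) then (i : ℕ) else g n + 1 := fun n => rfl
  have hlt : ∀ n, g n < j := by
    intro n
    induction n with
    | zero => exact (Nat.zero_le _).trans_lt hij'
    | succ n ih =>
      rw [hg]
      split_ifs <;> omega
  refine ⟨fun n => s (g n), rfl, fun n => ?_⟩
  have h1 := h (g n) (by have := hlt n; omega)
  simp only [hg]
  split_ifs with h2
  · rw [h2, ← hs] at h1
    exact h1
  · exact h1

/-- If a sufficiently long valid word avoids some patterns then arbitrarily long ones do. -/
theorem exists_avoiding_word {ι : Type} [Fintype ι] {k : ι → ℕ} (r : ∀ b, Fin (k b) → ℕ)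
    {u : ℕ → Letter} {m : ℕ} (hm : Nat.card (Letter × ∀ b, Set (Profile (k b))) ≤ m)
    (hu : Valid u (m + 1)) (hr : ∀ b, ¬ WordContains u (m + 1) (r b)) (N : ℕ) :
    ∃ u', Valid u' (N + 1) ∧ ∀ b, ¬ WordContains u' (N + 1) (r b) := by
  classical
  have : Fintype (Letter × ∀ b, Set (Profile (k b))) := Fintype.ofFinite _
  rw [Nat.card_eq_fintype_card] at hm
  -- The last letter must be part of the state because validity compares consecutive letters.
  -- Avoidance is required at the source of each edge, so it holds all along an infinite walk.
  let R : (Letter × ∀ b, Set (Profile (k b))) → (Letter × ∀ b, Set (Profile (k b))) → Prop :=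
    fun x y => letterNext x.1 y.1 ∧ (∀ b, y.2 b = profilesStep (r b) y.1 (x.2 b)) ∧
      ∀ b, ∀ s ∈ x.2 b, ¬ ∀ i, s.1 i ≠ none
  obtain ⟨s', h0, hs'⟩ := exists_infinite_walk (R := R)
    (fun n => (u n, fun b => profiles u (n + 1) (r b))) fun i hi => by
      refine ⟨hu.2 i (by omega), fun b => profiles_succ u (i + 1) (r b), fun b s hs hall => ?_⟩
      exact hr b ((wordContains_iff_profiles.2 ⟨s, hs, hall⟩).mono (by omega))
  have hprof : ∀ n b, profiles (fun n => (s' n).1) (n + 1) (r b) = (s' n).2 b := by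
    intro n b
    induction n with
    | zero =>
      rw [profiles_succ, profiles_zero _ u, h0, ← profiles_succ]
    | succ n ih =>
      rw [profiles_succ, ih]
      exact ((hs' n).2.1 b).symm
  refine ⟨fun n => (s' n).1, ⟨?_, fun i _ => (hs' i).1⟩, fun b hc => ?_⟩
  · simpa [h0] using hu.1
  · obtain ⟨s, hs, hall⟩ := wordContains_iff_profiles.1 hc
    rw [hprof] at hs
    exact (hs' N).2.2 b s hs hall

/-- An upper bound for the number of states needed to recognize the patterns in a list. -/
def stateBound (w : List (List ℕ)) : ℕ :=
  64 * (w.map fun l => 2 ^ (65 ^ l.length * (l.length + 1))).prod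

/-- There are 64 letters, and each of the `l.length` pattern points is unplaced or carries a letter,
giving the base 65. -/
theorem card_states (w : List (List ℕ)) :
    Nat.card (Letter × ∀ b : Fin w.length, Set (Profile w[b].length)) = stateBound w := by
  classical
  rw [Nat.card_prod, Nat.card_pi, stateBound]
  congr 1
  · simp [Nat.card_eq_fintype_card]
  · rw [← Fin.prod_univ_fun_getElem]
    refine Finset.prod_congr rfl fun b _ => ?_
    simp [Nat.card_eq_fintype_card, Profile]

/-! ### Computability -/

/-- All lists of length `n` with entries in `L`. -/
def tuples {α : Type*} (L : List α) (n : ℕ) : List (List α) :=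
  Nat.rec [[]] (fun _ acc => acc.flatMap fun t => L.map fun a => a :: t) n

theorem mem_tuples {α : Type*} {L : List α} {n : ℕ} {t : List α} :
    t ∈ tuples L n ↔ t.length = n ∧ ∀ a ∈ t, a ∈ L := by
  induction n generalizing t with
  | zero =>
    change t ∈ [[]] ↔ _
    rw [List.mem_singleton, List.length_eq_zero_iff]
    exact ⟨fun h => ⟨h, by simp [h]⟩, fun h => h.1⟩
  | succ n ih =>
    change t ∈ (tuples L n).flatMap _ ↔ _
    simp only [List.mem_flatMap, List.mem_map, ih]
    constructor
    · rintro ⟨t', ⟨h1, h2⟩, a, ha, rfl⟩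
      exact ⟨by simp [h1], by simpa using ⟨ha, h2⟩⟩
    · rintro ⟨h1, h2⟩
      rcases t with _ | ⟨a, t⟩
      · simp at h1
      · simp only [List.length_cons, Nat.add_right_cancel_iff] at h1
        simp only [List.mem_cons, forall_eq_or_imp] at h2
        exact ⟨t, ⟨h1, h2.2⟩, a, h2.1, rfl⟩

theorem primrec_tuples {α : Type*} [Primcodable α] : Primrec₂ (tuples (α := α)) := by
  refine Primrec.nat_rec (f := fun _ : List α => [[]])
    (g := fun L p => p.2.flatMap fun t => L.map fun a => a :: t) (Primrec.const _) ?_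
  refine Primrec.list_flatMap (Primrec.snd.comp Primrec.snd) ?_
  refine Primrec.list_map (Primrec.fst.comp Primrec.fst) ?_
  exact Primrec.list_cons.comp Primrec.snd (Primrec.snd.comp Primrec.fst)

/-- The letters of a list as a word. -/
def wordOf (v : List Letter) (i : ℕ) : Letter := v.getD i ((false, false, false), 0)

theorem primrec_wordOf : Primrec₂ wordOf := Primrec.list_getD _

theorem primrec_pow : Primrec₂ ((· ^ ·) : ℕ → ℕ → ℕ) :=
  Primrec₂.unpaired'.1 Nat.Primrec.pow

theorem primrec_stateBound : Primrec stateBound := by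
  have h : Primrec fun w : List (List ℕ) =>
      w.foldr (fun l m => 2 ^ (65 ^ l.length * (l.length + 1)) * m) 1 := by
    refine Primrec.list_foldr Primrec.id (Primrec.const 1)
      (h := fun _ (p : List ℕ × ℕ) => 2 ^ (65 ^ p.1.length * (p.1.length + 1)) * p.2) ?_
    have hl : Primrec fun p : List (List ℕ) × List ℕ × ℕ => p.2.1.length :=
      Primrec.list_length.comp (Primrec.fst.comp Primrec.snd)
    exact Primrec.nat_mul.comp (primrec_pow.comp (Primrec.const 2) (Primrec.nat_mul.comp
      (primrec_pow.comp (Primrec.const 65) hl) (Primrec.succ.comp hl)))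
      (Primrec.snd.comp Primrec.snd)
  refine (Primrec.nat_mul.comp (Primrec.const 64) h).of_eq fun w => ?_
  unfold stateBound
  congr 1
  induction w with
  | nil => rfl
  | cons l w ih => simp [ih]

theorem primrecPred_imp {α : Type*} [Primcodable α] {p q : α → Prop} (hp : PrimrecPred p)
    (hq : PrimrecPred q) : PrimrecPred fun a => p a → q a :=
  (hp.not.or hq).of_eq fun _ => imp_iff_not_or.symm

theorem primrecPred_exists_mem {α β : Type*} [Primcodable α] [Primcodable β] {p : α → β → Prop}
    {g : α → List β} (hg : Primrec g) (hp : PrimrecPred fun x : α × β => p x.1 x.2) :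
    PrimrecPred fun a => ∃ b ∈ g a, p a b :=
  (PrimrecRel.exists_mem_list (R := fun (b : β) (a : α) => p a b)
    (hp.comp (Primrec.snd.pair Primrec.fst))).comp hg Primrec.id

theorem primrecPred_forall_mem {α β : Type*} [Primcodable α] [Primcodable β] {p : α → β → Prop}
    {g : α → List β} (hg : Primrec g) (hp : PrimrecPred fun x : α × β => p x.1 x.2) :
    PrimrecPred fun a => ∀ b ∈ g a, p a b :=
  (PrimrecRel.forall_mem_list (R := fun (b : β) (a : α) => p a b)
    (hp.comp (Primrec.snd.pair Primrec.fst))).comp hg Primrec.id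

theorem primrecPred_forall_lt {α : Type*} [Primcodable α] {p : α → ℕ → Prop} {g : α → ℕ}
    (hg : Primrec g) (hp : PrimrecPred fun x : α × ℕ => p x.1 x.2) :
    PrimrecPred fun a => ∀ i < g a, p a i :=
  (primrecPred_forall_mem (Primrec.list_range.comp hg) hp).of_eq fun a => by simp

/-- The entries of `p` are positions of points of the word `v` that form the pattern `l`. -/
def OccursAt (v : List Letter) (l p : List ℕ) : Prop :=
  ∀ i < l.length, ∀ j < l.length, (p.getD i 0 = p.getD j 0 → i = j) ∧
    (p.getD i 0 < p.getD j 0 →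
      letterX (wordOf v (p.getD i 0)) (wordOf v (p.getD j 0))
        (decide (p.getD j 0 = p.getD i 0 + 1)) = decide (i < j) ∧
      letterY (wordOf v (p.getD i 0)) (wordOf v (p.getD j 0))
        (decide (p.getD j 0 = p.getD i 0 + 1)) = decide (l.getD i 0 < l.getD j 0))

theorem primrecPred_occursAt :
    PrimrecPred fun x : List Letter × List ℕ × List ℕ => OccursAt x.1 x.2.1 x.2.2 := by
  have hlen : Primrec fun x : List Letter × List ℕ × List ℕ => x.2.1.length :=
    Primrec.list_length.comp (Primrec.fst.comp Primrec.snd)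
  refine primrecPred_forall_lt hlen (primrecPred_forall_lt (hlen.comp Primrec.fst) ?_)
  let T := ((List Letter × List ℕ × List ℕ) × ℕ) × ℕ
  have hv : Primrec fun x : T => x.1.1.1 := Primrec.fst.comp (Primrec.fst.comp Primrec.fst)
  have hl : Primrec fun x : T => x.1.1.2.1 :=
    Primrec.fst.comp (Primrec.snd.comp (Primrec.fst.comp Primrec.fst))
  have hp : Primrec fun x : T => x.1.1.2.2 :=
    Primrec.snd.comp (Primrec.snd.comp (Primrec.fst.comp Primrec.fst))
  have hi : Primrec fun x : T => x.1.2 := Primrec.snd.comp Primrec.fst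
  have hj : Primrec fun x : T => x.2 := Primrec.snd
  have hget := Primrec.list_getD (0 : ℕ)
  have hpi : Primrec fun x : T => x.1.1.2.2.getD x.1.2 0 := hget.comp hp hi
  have hpj : Primrec fun x : T => x.1.1.2.2.getD x.2 0 := hget.comp hp hj
  have hli : Primrec fun x : T => x.1.1.2.1.getD x.1.2 0 := hget.comp hl hi
  have hlj : Primrec fun x : T => x.1.1.2.1.getD x.2 0 := hget.comp hl hj
  have hvi := primrec_wordOf.comp hv hpi
  have hvj := primrec_wordOf.comp hv hpj
  have hadj := (Primrec.eq.comp hpj (Primrec.succ.comp hpi)).decide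
  have hlet : ∀ F : Letter → Letter → Bool → Bool,
      Primrec fun x : Letter × Letter × Bool => F x.1 x.2.1 x.2.2 := fun F => Primrec.dom_finite _
  have hx := (hlet letterX).comp (hvi.pair (hvj.pair hadj))
  have hy := (hlet letterY).comp (hvi.pair (hvj.pair hadj))
  have hij := (Primrec.nat_lt.comp hi hj).decide
  have hlij := (Primrec.nat_lt.comp hli hlj).decide
  exact (primrecPred_imp (Primrec.eq.comp hpi hpj) (Primrec.eq.comp hi hj)).and
    (primrecPred_imp (Primrec.nat_lt.comp hpi hpj) ((Primrec.eq.comp hx hij).and (Primrec.eq.comp hy hlij)))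

/-- The pattern `l` occurs among the points of the word `v`. -/
def Occurs (v : List Letter) (l : List ℕ) : Prop :=
  ∃ p ∈ tuples (List.range v.length) l.length, OccursAt v l p

theorem primrecPred_occurs : PrimrecPred fun x : List Letter × List ℕ => Occurs x.1 x.2 := by
  refine primrecPred_exists_mem (primrec_tuples.comp
    (Primrec.list_range.comp (Primrec.list_length.comp Primrec.fst))
    (Primrec.list_length.comp Primrec.snd)) ?_
  exact primrecPred_occursAt.comp ((Primrec.fst.comp Primrec.fst).pair
    ((Primrec.snd.comp Primrec.fst).pair Primrec.snd))

theorem occurs_iff {v : List Letter} {l : List ℕ} :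
    Occurs v l ↔ WordContains (wordOf v) v.length fun i : Fin l.length => l[i] := by
  constructor
  · rintro ⟨p, hp, h⟩
    obtain ⟨hlen, hmem⟩ := mem_tuples.1 hp
    refine ⟨fun i => p.getD i 0, fun i j hij => Fin.ext ((h i i.2 j j.2).1 hij), fun i => ?_,
      fun i j hij => ?_⟩
    · have hi : (i : ℕ) < p.length := by rw [hlen]; exact i.2
      simp only [List.getD_eq_getElem _ _ hi]
      exact List.mem_range.1 (hmem _ (List.getElem_mem hi))
    · have := (h i i.2 j j.2).2 hij
      rw [List.getD_eq_getElem l 0 i.2, List.getD_eq_getElem l 0 j.2] at this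
      exact this
  · rintro ⟨f, h1, h2, h3⟩
    have hf : ∀ i (hi : i < l.length), (List.ofFn f).getD i 0 = f ⟨i, hi⟩ := fun i hi => by
      rw [List.getD_eq_getElem _ _ (by simpa using hi), List.getElem_ofFn]
    refine ⟨List.ofFn f, mem_tuples.2 ⟨by simp, fun a ha => ?_⟩, fun i hi j hj => ?_⟩
    · obtain ⟨i, rfl⟩ := (List.mem_ofFn' f a).1 ha
      exact List.mem_range.2 (h2 i)
    · rw [hf i hi, hf j hj]
      refine ⟨fun h => by simpa using h1 h, fun h => ?_⟩
      have := h3 _ _ h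
      rw [List.getD_eq_getElem l 0 hi, List.getD_eq_getElem l 0 hj]
      exact this

/-- The letters of `v` form a valid word. -/
def ValidList (v : List Letter) : Prop :=
  baseStart (wordOf v 0).2 ∧ ∀ i < v.length - 1, letterNext (wordOf v i) (wordOf v (i + 1))

theorem primrecPred_validList : PrimrecPred ValidList := by
  classical
  have h1 : PrimrecPred fun a : Letter => baseStart a.2 :=
    Primrec.primrecPred (Primrec.dom_finite _)
  have h2 : PrimrecPred fun x : Letter × Letter => letterNext x.1 x.2 :=
    Primrec.primrecPred (Primrec.dom_finite _)
  refine (h1.comp (primrec_wordOf.comp Primrec.id (Primrec.const 0))).and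
    (primrecPred_forall_lt (Primrec.pred.comp Primrec.list_length) ?_)
  exact h2.comp ((primrec_wordOf.comp Primrec.fst Primrec.snd).pair
    (primrec_wordOf.comp Primrec.fst (Primrec.succ.comp Primrec.snd)))

/-- The list `l` is the one-line notation of a permutation. -/
def IsOneLine (l : List ℕ) : Prop :=
  ∀ i < l.length, (1 ≤ l.getD i 0 ∧ l.getD i 0 ≤ l.length) ∧
    ∀ j < l.length, l.getD i 0 = l.getD j 0 → i = j

theorem primrecPred_isOneLine : PrimrecPred IsOneLine := by
  have hget := Primrec.list_getD (0 : ℕ)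
  have hi : Primrec fun x : List ℕ × ℕ => x.1.getD x.2 0 := hget.comp Primrec.fst Primrec.snd
  refine primrecPred_forall_lt Primrec.list_length (((Primrec.nat_le.comp (Primrec.const 1) hi).and
    (Primrec.nat_le.comp hi (Primrec.list_length.comp Primrec.fst))).and
    (primrecPred_forall_lt (Primrec.list_length.comp Primrec.fst) ?_))
  exact primrecPred_imp (Primrec.eq.comp (hi.comp Primrec.fst)
    (hi.comp ((Primrec.fst.comp Primrec.fst).pair Primrec.snd)))
    (Primrec.eq.comp (Primrec.snd.comp Primrec.fst) Primrec.snd)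

theorem isOneLine_iff {l : List ℕ} : IsOneLine l ↔ ∃ β : Permutation, β.oneLine = l := by
  constructor
  · intro h
    have hg : ∀ i : Fin l.length, l.getD i 0 = l[i] := fun i => List.getD_eq_getElem l 0 i.2
    let σ : Fin l.length → Fin l.length := fun i => ⟨l[i] - 1, by
      have := (h i i.2).1
      rw [hg] at this
      omega⟩
    have hσ : Function.Injective σ := fun i j hij => by
      have h1 := (h i i.2).1
      have h2 := (h j j.2).1
      have h3 := (h i i.2).2 j j.2
      rw [hg] at h1 h2 h3
      rw [hg] at h3
      have h4 : l[i] - 1 = l[j] - 1 := congrArg Fin.val hij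
      exact Fin.ext (h3 (by omega))
    refine ⟨⟨l.length, Equiv.ofBijective σ (Finite.injective_iff_bijective.1 hσ)⟩, ?_⟩
    refine List.ext_getElem (by simp [Permutation.oneLine]) fun i h1 h2 => ?_
    have h3 := (h i h2).1
    rw [List.getD_eq_getElem l 0 h2] at h3
    simp only [Permutation.oneLine, List.getElem_ofFn, Equiv.ofBijective_apply, σ, Fin.getElem_fin]
    omega
  · rintro ⟨β, rfl⟩ i hi
    have hlen : β.oneLine.length = β.1 := by simp [Permutation.oneLine]
    have hg : ∀ i (hi : i < β.1), β.oneLine.getD i 0 = (β.2 ⟨i, hi⟩ : ℕ) + 1 := fun i hi => by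
      rw [List.getD_eq_getElem _ _ (by rw [hlen]; exact hi)]
      simp [Permutation.oneLine]
    rw [hlen] at hi ⊢
    refine ⟨?_, fun j hj h => ?_⟩
    · rw [hg i hi]
      have := (β.2 ⟨i, hi⟩).2
      omega
    · rw [hg i hi, hg j hj] at h
      have h1 : β.2 ⟨i, hi⟩ = β.2 ⟨j, hj⟩ := Fin.ext (by omega)
      simpa using β.2.injective h1

theorem wordContains_oneLine {u : ℕ → Letter} {N : ℕ} {β : Permutation} :
    WordContains u N (fun i : Fin β.oneLine.length => β.oneLine[i]) ↔
      WordContains u N fun i => (β.2 i : ℕ) := by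
  have hlen : β.oneLine.length = β.1 := by simp [Permutation.oneLine]
  have he : ∀ i j : Fin β.oneLine.length, β.oneLine[i] < β.oneLine[j] ↔
      (β.2 (Fin.castOrderIso hlen i) : ℕ) < β.2 (Fin.castOrderIso hlen j) := fun i j => by
    have hg : ∀ i : Fin β.oneLine.length, β.oneLine[i] = (β.2 (Fin.castOrderIso hlen i) : ℕ) + 1 :=
      fun i => by
        change β.oneLine[(i : ℕ)] = _
        simp only [Permutation.oneLine, List.getElem_ofFn]
        rfl
    rw [hg, hg, Nat.add_lt_add_iff_right]
  refine ⟨fun h => wordContains_orderIso (Fin.castOrderIso hlen).symm (fun i j => ?_) h,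
    wordContains_orderIso (Fin.castOrderIso hlen) he⟩
  rw [he]
  simp

/-- The decision procedure: search for a valid word of bounded length that avoids all patterns. -/
def Decision (w : List (List ℕ)) : Prop :=
  (∀ l ∈ w, IsOneLine l) ∧
    ∃ v ∈ tuples (Finset.univ : Finset Letter).toList (stateBound w + 1),
      ValidList v ∧ ∀ l ∈ w, ¬ Occurs v l

theorem primrecPred_decision : PrimrecPred Decision := by
  refine (primrecPred_forall_mem Primrec.id (primrecPred_isOneLine.comp Primrec.snd)).and
    (primrecPred_exists_mem (primrec_tuples.comp (Primrec.const _)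
      (Primrec.succ.comp primrec_stateBound)) ((primrecPred_validList.comp Primrec.snd).and
      (primrecPred_forall_mem Primrec.fst ?_)))
  exact (primrecPred_occurs.comp ((Primrec.snd.comp Primrec.fst).pair Primrec.snd)).not

theorem exists_validList_iff (w : List (List ℕ)) (m : ℕ) :
    (∃ v ∈ tuples (Finset.univ : Finset Letter).toList (m + 1),
      ValidList v ∧ ∀ l ∈ w, ¬ Occurs v l) ↔
    ∃ u, Valid u (m + 1) ∧ ∀ l ∈ w, ¬ WordContains u (m + 1) fun i : Fin l.length => l[i] := by
  constructor
  · rintro ⟨v, hv, ⟨h0, h1⟩, h2⟩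
    obtain ⟨hlen, -⟩ := mem_tuples.1 hv
    refine ⟨wordOf v, ⟨h0, fun i hi => h1 i (by omega)⟩, fun l hl hc => h2 l hl ?_⟩
    rw [occurs_iff, hlen]
    exact hc
  · rintro ⟨u, hu, hw⟩
    have hlen : (List.ofFn fun i : Fin (m + 1) => u i).length = m + 1 := by simp
    have hval : ∀ i < m + 1, wordOf (List.ofFn fun i : Fin (m + 1) => u i) i = u i := fun i hi => by
      rw [wordOf, List.getD_eq_getElem _ _ (by simpa using hi), List.getElem_ofFn]
    refine ⟨List.ofFn fun i : Fin (m + 1) => u i, mem_tuples.2 ⟨hlen, by simp⟩,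
      ⟨by rw [hval 0 (by omega)]; exact hu.1, fun i hi => ?_⟩, fun l hl hc => hw l hl ?_⟩
    · rw [hlen] at hi
      rw [hval i (by omega), hval (i + 1) (by omega)]
      exact hu.2 i (by omega)
    · rw [occurs_iff, hlen] at hc
      obtain ⟨f, h1, h2, h3⟩ := hc
      refine ⟨f, h1, h2, fun i j hij => ?_⟩
      have := h3 i j hij
      rwa [hval _ (h2 i), hval _ (h2 j)] at this

/-- Searching a single length suffices: an avoiding word of length `stateBound w + 1` pumps to all
lengths, and conversely an infinite family of simple permutations supplies one of that length. -/
theorem decision_iff (w : List (List ℕ)) : Decision w ↔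
    ∃ B : List Permutation, w = B.map Permutation.oneLine ∧
      {π : Permutation | π ∈ Permutation.Av {β | β ∈ B} ∧ π.IsSimple}.Infinite := by
  have hword : ∀ (B : List Permutation) (N : ℕ) (u : ℕ → Letter),
      (∀ l ∈ B.map Permutation.oneLine, ¬ WordContains u N fun i : Fin l.length => l[i]) ↔
        ∀ β ∈ {β | β ∈ B}, ¬ WordContains u N fun i => (β.2 i : ℕ) := by
    intro B N u
    simp only [List.mem_map, forall_exists_index, and_imp, forall_apply_eq_imp_iff₂,
      wordContains_oneLine, Set.mem_ofPred_eq]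
  unfold Decision
  rw [exists_validList_iff]
  constructor
  · rintro ⟨hw, u, hu, hav⟩
    obtain ⟨B, rfl⟩ : ∃ B : List Permutation, w = B.map Permutation.oneLine := by
      have : w ∈ Set.range (List.map Permutation.oneLine) := by
        rw [Set.range_list_map]
        exact fun l hl => isOneLine_iff.1 (hw l hl)
      obtain ⟨B, rfl⟩ := this
      exact ⟨B, rfl⟩
    refine ⟨B, rfl, (infinite_simple_iff _).2 fun N => ?_⟩
    obtain ⟨u', hu', hav'⟩ := exists_avoiding_word
      (fun b : Fin (B.map Permutation.oneLine).length =>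
        fun i : Fin (B.map Permutation.oneLine)[b].length => (B.map Permutation.oneLine)[b][i])
      (card_states _).le hu (fun b => hav _ (List.getElem_mem b.2)) N
    refine ⟨u', hu', (hword B (N + 1) u').1 fun l hl => ?_⟩
    obtain ⟨b, hb, rfl⟩ := List.getElem_of_mem hl
    exact hav' ⟨b, hb⟩
  · rintro ⟨B, rfl, hB⟩
    refine ⟨fun l hl => ?_, ?_⟩
    · obtain ⟨β, -, rfl⟩ := List.mem_map.1 hl
      exact isOneLine_iff.2 ⟨β, rfl⟩
    · obtain ⟨u, hu, hav⟩ := (infinite_simple_iff _).1 hB (stateBound (B.map Permutation.oneLine))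
      exact ⟨u, hu, (hword B _ u).2 hav⟩

end PinWords

theorem mainTheorem7 :
    ComputablePred fun w : List (List ℕ) =>
      ∃ B : List Permutation, w = B.map Permutation.oneLine ∧
        {π : Permutation | π ∈ Permutation.Av {β | β ∈ B} ∧ π.IsSimple}.Infinite := by
  exact PinWords.primrecPred_decision.computablePred.of_eq PinWords.decision_iff
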